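/- For $n\ge 1$ and $\beta\in\mathbb R$, let $\mathbb P_n^{(\beta)}$ be the Curie--Weiss law of $n$ spins: the law of $n$ i.i.d. symmetric $\{\pm1\}$-valued signs $X_1,\dots,X_n$, biased by the density $e^{\frac{\beta}{2n}S_n^2}/\mathbb E\big[e^{\frac{\beta}{2n}S_n^2}\big]$, where $S_n=X_1+\dots+X_n$. Let $M_n^{(\beta)}=\sum_{k=1}^n X_k^{(\beta)}$ with $(X_k^{(\beta)})_{k\le n}\sim\mathbb P_n^{(\beta)}$. For $\beta>0$ let $\widetilde\nu_{n,\beta}$ be the probability measure on $(0,1)$ with density $$\frac1{\mathcal Z_{n,\beta}}\exp\Big(-\tfrac{n}{2\beta}\operatorname{artanh}(2p-1)^2-\big(\tfrac n2+1\big)\log\big(1-(2p-1)^2\big)\Big).$$ If $U_1,\dots,U_n$ are i.i.d. uniform on $[0,1]$ and independent of $\widetilde V_{n,\beta}\sim\widetilde\nu_{n,\beta}$, then $\big(2\cdot\mathbf 1_{\{U_k<\widetilde V_{n,\beta}\}}-1\big)_{k\le n}$ has law $\mathbb P_n^{(\beta)}$; in this coupling $M_n^{(\beta)}=\sum_{k=1}^n\big(2\cdot\mathbf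 1_{\{U_k<\widetilde V_{n,\beta}\}}-1\big)$, and one sets $T_n^{(\beta)}:=2\widetilde V_{n,\beta}-1$. Let $\gamma\in\mathbb R$ and $\beta_n=1-\gamma/\sqrt n$ (which is positive for $n$ large). Let $F_\gamma$ be a random variable with law $$\mathbb P(F_\gamma\in dx)=\frac{1}{\mathcal Z_{F_\gamma}}e^{-\frac{x^4}{12}-\gamma\frac{x^2}{2}}\,dx,\qquad \mathcal Z_{F_\gamma}=\int_{\mathbb R}e^{-\frac{x^4}{12}-\gamma\frac{x^2}{2}}\,dx<\infty .$$ Then, as $n\to\infty$, $$\frac{M_n^{(\beta_n)}}{n^{3/4}}\to F_\gamma\quad\text{in law},$$ and, in the above coupling, $$\Big(n^{1/4}\Big(\frac{M_n^{(\beta_n)}}{n^{3/4}}-n^{1/4}T_n^{(\beta_n)}\Big),\;n^{1/4}T_n^{(\beta_n)}\Big)\to(G,F_\gamma)\quad\text{in law},$$ where $G\sim\mathcal N(0,1)$ is independent of $F_\gamma$. In particular, for $\gamma=0$ (that is, $\beta_n=1$ for all $n$) both convergences hold with $F:=F_0$, whose law is $\frac1{\mathcal Z_F}e^{-x^4/12}dx$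 with $\mathcal Z_F=\int_{\mathbb R}e^{-x^4/12}dx=3^{1/4}\,2^{-1/2}\,\Gamma(1/4)$. Moreover $F$ has the same law as $B\,\big(12\,\boldsymbol\gamma(1/4)\big)^{1/4}$, where $B$ is uniform on $\{-1,1\}$ and independent of $\boldsymbol\gamma(1/4)$, which has the Gamma law of shape $1/4$ and rate $1$, with density $\Gamma(1/4)^{-1}x^{-3/4}e^{-x}\mathbf 1_{\{x>0\}}$. -/

import Mathlib

open MeasureTheory ProbabilityTheory Filter

noncomputable section

namespace CurieWeiss

/-- The symmetric Bernoulli law on `{-1, 1}`. -/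
def spinLaw : Measure ℝ :=
  bernoulliMeasure (1 : ℝ) (-1) ⟨1 / 2, by norm_num, by norm_num⟩

/-- The Curie-Weiss law of `n` spins at inverse temperature `β`: the law of `n` i.i.d. symmetric
signs, biased by `exp (β S² / (2 n))`, where `S` is the sum of the signs. -/
def curieWeissMeasure (n : ℕ) (β : ℝ) : Measure (Fin n → ℝ) :=
  (Measure.pi fun _ : Fin n => spinLaw).tilted fun x => β / (2 * n) * (∑ k, x k) ^ 2

/-- The De Finetti measure of the Curie-Weiss model: the probability measure on `(0, 1)` with
density proportional to `exp (-(n / 2β) artanh(2p - 1)² - (n / 2 + 1) log (1 - (2p - 1)²))`. -/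
def deFinettiMeasure (n : ℕ) (β : ℝ) : Measure ℝ :=
  (volume.restrict (Set.Ioo (0 : ℝ) 1)).tilted fun p =>
    -(n / (2 * β)) * Real.artanh (2 * p - 1) ^ 2
      - (n / 2 + 1) * Real.log (1 - (2 * p - 1) ^ 2)

/-- The law on `ℝ` with density proportional to `exp (-x⁴ / 12 - γ x² / 2)`. -/
def limitLaw (γ : ℝ) : Measure ℝ :=
  (volume : Measure ℝ).tilted fun x => -(x ^ 4 / 12) - γ * (x ^ 2 / 2)

/-- The randomised spin `2 · 1_{u < v} - 1`. -/
def coupledSpin (u v : ℝ) : ℝ :=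
  2 * (if u < v then 1 else 0) - 1

/-- `U₁, …, Uₙ` are i.i.d. uniform on `[0, 1]` and independent of `V`, whose law is the De Finetti
measure. -/
structure IsUniformCoupling {Ω : Type*} [MeasurableSpace Ω] (n : ℕ) (β : ℝ)
    (U : Fin n → Ω → ℝ) (V : Ω → ℝ) (P : Measure Ω) : Prop where
  uniform : ∀ k, HasLaw (U k) (volume.restrict (Set.Icc (0 : ℝ) 1)) P
  iIndep : iIndepFun U P
  deFinetti : HasLaw V (deFinettiMeasure n β) P
  indep : IndepFun (fun ω k => U k ω) V P

end CurieWeiss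

end

noncomputable section

namespace CurieWeiss

open Real Topology

/-! Gaussian linearisation writes `exp (b S² / (2n))` as an average over a field `y` of `exp (y S)`
with Gaussian weight `exp (-n y² / (2b))`. Given `y` the spins are i.i.d. with mean `tanh y`, and
`y` has density proportional to `exp (-n y² / (2b) + n log (cosh y))`, the `fieldLaw`. Its image
under `(1 + tanh y) / 2` is the De Finetti measure (`deFinettiMeasure_eq_map`), so the uniform
coupling yields Curie-Weiss spins (`map_coupledSpin_eq_curieWeissMeasure`).

For `b = 1 - γ / √n` and `y = x / n^(1/4)` the exponent is `-(γ/b) x²/2 - n (y²/2 - log (cosh y))`,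
which tends to `-γ x²/2 - x⁴/12`. Two-sided bounds on `y²/2 - log (cosh y)` give this limit and a
Gaussian domination uniform in `n`, so dominated convergence applies even to test functions varying
with `n` (`tendsto_integral_fieldLaw`).

Given the field, the centred magnetisation over `√n` is a sum of independent terms of variance `1 -
tanh² y → 1`, so its conditional characteristic function tends to `exp (-s²/2)`, which is free of
`x`: hence the independent Gaussian (`tendsto_integral_centredSpinChar`). Lévy's theorem concludes.
The magnetisation itself is the same computation with `s` replaced by `t / n^(1/4) → 0`. -/

/-! ### Elementary bounds for `tanh` and `log cosh`. -/

lemma nonneg_of_second_deriv_nonneg {f f' f'' : ℝ → ℝ} (hf : ∀ x, HasDerivAt f (f' x) x)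
    (hf' : ∀ x, HasDerivAt f' (f'' x) x) (h0 : f 0 = 0) (h0' : f' 0 = 0)
    (h : ∀ x, 0 ≤ f'' x) (x : ℝ) (hx : 0 ≤ x) : 0 ≤ f x := by
  have hm' : Monotone f' := monotone_of_hasDerivAt_nonneg hf' h
  have hm : MonotoneOn f (Set.Ici 0) := by
    refine monotoneOn_of_hasDerivWithinAt_nonneg (convex_Ici 0)
      (fun y _ => (hf y).continuousAt.continuousWithinAt) (f' := f')
      (fun y _ => (hf y).hasDerivWithinAt) fun y hy => ?_
    rw [interior_Ici] at hy
    simpa [h0'] using hm' (le_of_lt hy)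
  simpa [h0] using hm (Set.mem_Ici.2 le_rfl) (Set.mem_Ici.2 hx) hx

lemma hasDerivAt_tanh (x : ℝ) : HasDerivAt tanh (1 - tanh x ^ 2) x := by
  have hc : cosh x ≠ 0 := (cosh_pos x).ne'
  have h := (hasDerivAt_sinh x).div (hasDerivAt_cosh x) hc
  have he : tanh = sinh / cosh := by ext y; simp [tanh_eq_sinh_div_cosh]
  rw [he]
  refine h.congr_deriv ?_
  simp only [Pi.div_apply]
  field_simp

lemma hasDerivAt_log_cosh (x : ℝ) : HasDerivAt (fun y => log (cosh y)) (tanh x) x := by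
  simpa [tanh_eq_sinh_div_cosh] using (hasDerivAt_cosh x).log (cosh_pos x).ne'

lemma one_sub_tanh_sq (x : ℝ) : 1 - tanh x ^ 2 = (cosh x ^ 2)⁻¹ := by
  have hc : cosh x ≠ 0 := (cosh_pos x).ne'
  rw [tanh_eq_sinh_div_cosh]
  field_simp
  rw [cosh_sq]; ring

lemma sq_le_sinh_sq (x : ℝ) : x ^ 2 ≤ sinh x ^ 2 := by
  refine sq_le_sq.2 ?_
  rcases le_total 0 x with h | h
  · rw [abs_of_nonneg h, abs_of_nonneg (sinh_nonneg_iff.2 h)]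
    exact self_le_sinh_iff.2 h
  · rw [abs_of_nonpos h, abs_of_nonpos (sinh_nonpos_iff.2 h)]
    exact neg_le_neg (sinh_le_self_iff.2 h)

/-- Since `tanh² = sinh² / (1 + sinh²)` and `t / (1 + t)` increases, this follows from `x² ≤ sinh²
x`. -/
lemma sq_div_one_add_sq_le_tanh_sq (x : ℝ) : x ^ 2 / (1 + x ^ 2) ≤ tanh x ^ 2 := by
  have h := sq_le_sinh_sq x
  rw [tanh_eq_sinh_div_cosh, div_pow, cosh_sq, div_le_div_iff₀ (by positivity) (by positivity)]
  nlinarith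

lemma tanh_sq_le_sq (x : ℝ) : tanh x ^ 2 ≤ x ^ 2 := by
  have key : ∀ y, 0 ≤ y → tanh y ≤ y := by
    have hm : Monotone fun y => y - tanh y :=
      monotone_of_hasDerivAt_nonneg (fun y => (hasDerivAt_id y).sub (hasDerivAt_tanh y))
        fun y => by simp only [Pi.zero_apply]; nlinarith [sq_nonneg (tanh y)]
    intro y hy
    have := hm hy
    simp at this
    exact this
  have hnn : ∀ y, 0 ≤ y → 0 ≤ tanh y := fun y hy => by
    rw [tanh_eq_sinh_div_cosh]
    exact div_nonneg (sinh_nonneg_iff.2 hy) (cosh_pos y).le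
  rcases le_total 0 x with h | h
  · exact pow_le_pow_left₀ (hnn x h) (key x h) 2
  · have := pow_le_pow_left₀ (hnn (-x) (by linarith)) (key (-x) (by linarith)) 2
    simpa using this

lemma forall_log_cosh_of_nonneg (P : ℝ → ℝ → Prop) (h : ∀ x, 0 ≤ x → P (|x|) (log (cosh x))) (x : ℝ) :
    P (|x|) (log (cosh x)) := by
  rcases le_total 0 x with hx | hx
  · exact h x hx
  · simpa using h (-x) (by linarith)

/-- Quartic upper bound for the defect of `log cosh` from its quadratic approximation. -/
lemma half_sq_sub_log_cosh_le (x : ℝ) : x ^ 2 / 2 - log (cosh x) ≤ x ^ 4 / 12 := by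
  have key : ∀ y, 0 ≤ y → |y| ^ 2 / 2 - log (cosh y) ≤ |y| ^ 4 / 12 := by
    intro y hy
    rw [abs_of_nonneg hy]
    -- The second derivative of `y²/2 - log (cosh y)` is `tanh² y`, so two integrations of `tanh² y
    -- ≤ y²` give the bound.
    have := nonneg_of_second_deriv_nonneg
      (f := fun y => y ^ 4 / 12 - (y ^ 2 / 2 - log (cosh y)))
      (f' := fun y => y ^ 3 / 3 - (y - tanh y)) (f'' := fun y => y ^ 2 - tanh y ^ 2)
      (fun y => by
        have := ((hasDerivAt_pow 4 y).div_const 12).sub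
          (((hasDerivAt_pow 2 y).div_const 2).sub (hasDerivAt_log_cosh y))
        refine this.congr_deriv ?_
        norm_num; ring)
      (fun y => by
        have := ((hasDerivAt_pow 3 y).div_const 3).sub ((hasDerivAt_id y).sub (hasDerivAt_tanh y))
        refine this.congr_deriv ?_
        norm_num)
      (by simp) (by simp) (fun y => by have := tanh_sq_le_sq y; linarith) y hy
    linarith
  have := forall_log_cosh_of_nonneg (fun a b => a ^ 2 / 2 - b ≤ a ^ 4 / 12) key x
  simpa [Even.pow_abs (show Even 4 by decide)] using this

/-- Lower bound for the defect of `log cosh` from its quadratic approximation, sharp near `0` and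
quadratic at infinity. -/
lemma le_half_sq_sub_log_cosh (x : ℝ) :
    x ^ 4 / (1 + x ^ 2) / 12 ≤ x ^ 2 / 2 - log (cosh x) := by
  have key : ∀ y, 0 ≤ y → |y| ^ 4 / (1 + |y| ^ 2) / 12 ≤ |y| ^ 2 / 2 - log (cosh y) := by
    intro y hy
    rw [abs_of_nonneg hy]
    have hd : ∀ y : ℝ, HasDerivAt (fun y : ℝ => 1 + y ^ 2) (2 * y) y := fun y => by
      simpa using (hasDerivAt_pow 2 y).const_add 1
    have hne : ∀ y : ℝ, 1 + y ^ 2 ≠ 0 := fun y => by positivity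
    -- The same scheme with `tanh² y ≥ y² / (1 + y²)`, which dominates the second derivative of the
    -- rational minorant.
    have := nonneg_of_second_deriv_nonneg
      (f := fun y => (y ^ 2 / 2 - log (cosh y)) - y ^ 4 / (1 + y ^ 2) / 12)
      (f' := fun y => (y - tanh y) - (4 * y ^ 3 + 2 * y ^ 5) / (1 + y ^ 2) ^ 2 / 12)
      (f'' := fun y => tanh y ^ 2 -
        ((12 * y ^ 2 + 10 * y ^ 4) * (1 + y ^ 2) - (4 * y ^ 3 + 2 * y ^ 5) * (4 * y))
          / (1 + y ^ 2) ^ 3 / 12)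
      (fun y => by
        have := (((hasDerivAt_pow 2 y).div_const 2).sub (hasDerivAt_log_cosh y)).sub
          (((hasDerivAt_pow 4 y).div (hd y) (hne y)).div_const 12)
        refine this.congr_deriv ?_
        norm_num
        have := hne y
        field_simp
        ring)
      (fun y => by
        have h2 : HasDerivAt (fun y : ℝ => 4 * y ^ 3 + 2 * y ^ 5) (12 * y ^ 2 + 10 * y ^ 4) y := by
          refine (((hasDerivAt_pow 3 y).const_mul 4).add
            ((hasDerivAt_pow 5 y).const_mul 2)).congr_deriv ?_
          norm_num; ring
        have := ((hasDerivAt_id y).sub (hasDerivAt_tanh y)).sub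
          ((h2.div ((hd y).pow 2) (pow_ne_zero 2 (hne y))).div_const 12)
        refine this.congr_deriv ?_
        norm_num
        have := hne y
        field_simp
        ring)
      (by simp) (by simp)
      (fun y => by
        have h1 := sq_div_one_add_sq_le_tanh_sq y
        refine sub_nonneg.2 (le_trans ?_ h1)
        rw [div_div, div_le_div_iff₀ (by positivity) (by positivity)]
        have := hne y
        have e : y ^ 2 * ((1 + y ^ 2) ^ 3 * 12) - ((12 * y ^ 2 + 10 * y ^ 4) * (1 + y ^ 2)
          - (4 * y ^ 3 + 2 * y ^ 5) * (4 * y)) * (1 + y ^ 2)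
          = y ^ 4 * (18 + 28 * y ^ 2 + 10 * y ^ 4) := by ring
        have : 0 ≤ y ^ 4 * (18 + 28 * y ^ 2 + 10 * y ^ 4) := by positivity
        linarith) y hy
    linarith
  have := forall_log_cosh_of_nonneg (fun a b => a ^ 4 / (1 + a ^ 2) / 12 ≤ a ^ 2 / 2 - b) key x
  simpa [Even.pow_abs (show Even 4 by decide)] using this

/-! ### The random external field and the De Finetti measure. -/

/-- Logarithm of the unnormalised density of the random external field whose hyperbolic tangent is
the centred mixing variable `2p - 1` of the De Finetti measure. -/
def fieldExponent (n : ℕ) (b y : ℝ) : ℝ := -(n / (2 * b)) * y ^ 2 + n * log (cosh y)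

/-- The law of the random external field. -/
def fieldLaw (n : ℕ) (b : ℝ) : Measure ℝ := (volume : Measure ℝ).tilted (fieldExponent n b)

/-- The probability of a positive spin in the external field `y`. -/
def successProb (y : ℝ) : ℝ := (1 + tanh y) / 2

lemma log_cosh_le_abs (y : ℝ) : log (cosh y) ≤ |y| := by
  rw [log_le_iff_le_exp (cosh_pos y), cosh_eq]
  have h1 := exp_le_exp.2 (le_abs_self y)
  have h2 := exp_le_exp.2 (neg_le_abs y)
  linarith

lemma continuous_fieldExponent (n : ℕ) (b : ℝ) : Continuous (fieldExponent n b) := by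
  have : Continuous fun y => log (cosh y) :=
    continuous_cosh.log fun y => (cosh_pos y).ne'
  unfold fieldExponent
  fun_prop

/-- As `log (cosh y) ≤ |y|`, half of the Gaussian exponent absorbs `n |y|` by completing the square,
and the other half gives integrability. -/
lemma integrable_exp_fieldExponent {n : ℕ} {b : ℝ} (hn : 0 < n) (hb : 0 < b) :
    Integrable (fun y => exp (fieldExponent n b y)) := by
  have hn' : (0 : ℝ) < n := by exact_mod_cast hn
  set a : ℝ := n / (2 * b) with ha
  have ha0 : 0 < a := by positivity
  refine Integrable.mono'
    ((integrable_exp_neg_mul_sq (half_pos ha0)).const_mul (exp ((n : ℝ) ^ 2 / (2 * a))))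
    (continuous_exp.comp (continuous_fieldExponent n b)).aestronglyMeasurable
    (Eventually.of_forall fun y => ?_)
  rw [norm_of_nonneg (exp_pos _).le, ← exp_add, exp_le_exp, fieldExponent, ← ha]
  have h1 : (n : ℝ) * log (cosh y) ≤ n * |y| := by gcongr; exact log_cosh_le_abs y
  have h2 : (n : ℝ) ^ 2 / (2 * a) + -(a / 2) * y ^ 2 - (-a * y ^ 2 + n * |y|)
      = (a * |y| - n) ^ 2 / (2 * a) := by
    rw [← sq_abs y]
    field_simp
    ring
  have h3 : 0 ≤ (a * |y| - n) ^ 2 / (2 * a) := by positivity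
  linarith

lemma isProbabilityMeasure_fieldLaw {n : ℕ} {b : ℝ} (hn : 0 < n) (hb : 0 < b) :
    IsProbabilityMeasure (fieldLaw n b) :=
  isProbabilityMeasure_tilted (integrable_exp_fieldExponent hn hb)

lemma hasDerivAt_successProb (y : ℝ) :
    HasDerivAt successProb ((cosh y ^ 2)⁻¹ / 2) y := by
  rw [← one_sub_tanh_sq]
  exact ((hasDerivAt_tanh y).const_add 1).div_const 2

lemma continuous_successProb : Continuous successProb :=
  continuous_iff_continuousAt.2 fun y => (hasDerivAt_successProb y).continuousAt

lemma two_mul_successProb_sub_one (y : ℝ) : 2 * successProb y - 1 = tanh y := by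
  unfold successProb; ring

lemma successProb_mem (y : ℝ) : successProb y ∈ Set.Ioo (0 : ℝ) 1 := by
  have h1 := neg_one_lt_tanh y
  have h2 := tanh_lt_one y
  constructor <;> unfold successProb <;> linarith

lemma injective_successProb : Function.Injective successProb := fun x y h => by
  refine tanh_injective ?_
  rw [← two_mul_successProb_sub_one, ← two_mul_successProb_sub_one, h]

/-- The change of variables formula is stated for images; this turns a subset of `(0, 1)` into one.
-/
lemma image_successProb (s : Set ℝ) :
    successProb '' (successProb ⁻¹' s) = s ∩ Set.Ioo 0 1 := by
  rw [Set.image_preimage_eq_inter_range]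
  congr 1
  refine Set.Subset.antisymm (Set.range_subset_iff.2 successProb_mem) fun p hp => ?_
  refine ⟨artanh (2 * p - 1), ?_⟩
  rw [successProb, tanh_artanh ⟨by linarith [hp.1], by linarith [hp.2]⟩]
  ring

/-- Because `1 - tanh² = 1 / cosh²`, the logarithmic term of the density becomes `(n + 2) log (cosh
y)`. The Jacobian removes exactly `2 log (cosh y)`, which accounts for the `+ 1` in `n / 2 + 1`. -/
lemma deriv_mul_deFinetti_density (n : ℕ) (b y : ℝ) :
    |(cosh y ^ 2)⁻¹ / 2| * exp (-(n / (2 * b)) * artanh (2 * successProb y - 1) ^ 2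
      - (n / 2 + 1) * log (1 - (2 * successProb y - 1) ^ 2))
      = 1 / 2 * exp (fieldExponent n b y) := by
  have hc := cosh_pos y
  rw [two_mul_successProb_sub_one, artanh_tanh, one_sub_tanh_sq, log_inv, log_pow,
    abs_of_pos (by positivity)]
  have h : (cosh y ^ 2)⁻¹ = exp (-(2 * log (cosh y))) := by
    rw [exp_neg, show 2 * log (cosh y) = log (cosh y ^ 2) by rw [log_pow]; norm_num,
      exp_log (by positivity)]
  rw [h, div_eq_inv_mul, mul_assoc, ← exp_add, one_div, fieldExponent]
  congr 2
  push_cast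
  ring

/-- The De Finetti measure is the law of the success probability in the random external field. -/
lemma deFinettiMeasure_eq_map {n : ℕ} {b : ℝ} :
    deFinettiMeasure n b = (fieldLaw n b).map successProb := by
  have hder : ∀ s : Set ℝ, ∀ y ∈ s, HasDerivWithinAt successProb ((cosh y ^ 2)⁻¹ / 2) s y :=
    fun s y _ => (hasDerivAt_successProb y).hasDerivWithinAt
  have hI : (∫ p in Set.Ioo (0 : ℝ) 1, exp (-(n / (2 * b)) * artanh (2 * p - 1) ^ 2
      - (n / 2 + 1) * log (1 - (2 * p - 1) ^ 2))) = 1 / 2 * ∫ y, exp (fieldExponent n b y) := by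
    have := image_successProb Set.univ
    rw [Set.univ_inter, Set.preimage_univ] at this
    rw [← this, integral_image_eq_integral_abs_deriv_smul MeasurableSet.univ (hder _)
      injective_successProb.injOn, setIntegral_univ, ← integral_const_mul]
    exact integral_congr_ae (Eventually.of_forall fun y => deriv_mul_deFinetti_density n b y)
  ext s hs
  have hs' := continuous_successProb.measurable hs
  rw [deFinettiMeasure, fieldLaw, Measure.map_apply continuous_successProb.measurable hs,
    tilted_apply' _ _ hs, tilted_apply' _ _ hs', Measure.restrict_restrict hs,
    ← image_successProb, lintegral_image_eq_lintegral_abs_deriv_mul hs' (hder _)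
      injective_successProb.injOn, hI]
  refine lintegral_congr fun y => ?_
  rw [← ENNReal.ofReal_mul (abs_nonneg _), ← mul_div_assoc, deriv_mul_deFinetti_density,
    mul_div_mul_left _ _ (by norm_num)]

lemma isProbabilityMeasure_deFinettiMeasure {n : ℕ} {b : ℝ} (hn : 0 < n) (hb : 0 < b) :
    IsProbabilityMeasure (deFinettiMeasure n b) := by
  have := isProbabilityMeasure_fieldLaw hn hb
  rw [deFinettiMeasure_eq_map]
  exact Measure.isProbabilityMeasure_map continuous_successProb.aemeasurable

/-! ### Tilted spins and the Curie-Weiss law as a mixture. -/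

instance : IsProbabilityMeasure spinLaw := by unfold spinLaw; infer_instance

instance : IsProbabilityMeasure ((volume : Measure ℝ).restrict (Set.Icc (0 : ℝ) 1)) :=
  ⟨by simp⟩

lemma integral_spinLaw {E : Type*} [NormedAddCommGroup E] [NormedSpace ℝ E] [CompleteSpace E]
    (f : ℝ → E) : ∫ x, f x ∂spinLaw = (1 / 2 : ℝ) • f 1 + (1 / 2 : ℝ) • f (-1) := by
  rw [spinLaw, integral_bernoulliMeasure]
  norm_num

lemma integrable_spinLaw {E : Type*} [NormedAddCommGroup E] [NormedSpace ℝ E] [CompleteSpace E]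
    (f : ℝ → E) : Integrable f spinLaw := integrable_bernoulliMeasure _ _ _ _

lemma integral_exp_mul_spinLaw (y : ℝ) : ∫ x, exp (y * x) ∂spinLaw = cosh y := by
  rw [integral_spinLaw, cosh_eq]
  simp
  ring

lemma integral_tilted_spinLaw (f : ℝ → ℝ) (y : ℝ) :
    ∫ x, f x ∂(spinLaw.tilted fun x => y * x)
      = successProb y * f 1 + (1 - successProb y) * f (-1) := by
  have hc : cosh y ≠ 0 := (cosh_pos y).ne'
  rw [integral_tilted, integral_exp_mul_spinLaw, integral_spinLaw, successProb,
    tanh_eq_sinh_div_cosh]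
  have e1 : exp (y * 1) = cosh y + sinh y := by rw [cosh_add_sinh]; simp
  have e2 : exp (y * -1) = cosh y - sinh y := by rw [cosh_sub_sinh]; simp
  rw [e1, e2]
  simp only [smul_eq_mul]
  field_simp
  ring

lemma measurable_coupledSpin : Measurable fun q : ℝ × ℝ => coupledSpin q.1 q.2 := by
  unfold coupledSpin
  exact ((Measurable.ite (measurableSet_lt measurable_fst measurable_snd) measurable_const
    measurable_const).const_mul 2).sub_const 1

lemma measurable_coupledSpin_left (v : ℝ) : Measurable fun u => coupledSpin u v :=
  measurable_coupledSpin.comp (measurable_id.prodMk measurable_const)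

lemma integral_coupledSpin {E : Type*} [NormedAddCommGroup E] [NormedSpace ℝ E] [CompleteSpace E]
    (f : ℝ → E) {v : ℝ} (hv : v ∈ Set.Ioo (0 : ℝ) 1) :
    ∫ u in Set.Icc (0 : ℝ) 1, f (coupledSpin u v) = v • f 1 + (1 - v) • f (-1) := by
  have h : ∀ u, f (coupledSpin u v)
      = (Set.Iio v).indicator (fun _ => f 1 - f (-1)) u + f (-1) := by
    intro u
    by_cases hu : u < v
    · simp [coupledSpin, hu]; norm_num
    · simp [coupledSpin, hu]
  simp_rw [h]
  rw [integral_add ((integrable_const _).indicator measurableSet_Iio) (integrable_const _),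
    integral_indicator measurableSet_Iio, setIntegral_const, integral_const]
  have h2 : Set.Iio v ∩ Set.Icc 0 1 = Set.Ico 0 v := by
    ext u
    simp only [Set.mem_inter_iff, Set.mem_Iio, Set.mem_Icc, Set.mem_Ico]
    constructor
    · rintro ⟨a, b, _⟩; exact ⟨b, a⟩
    · rintro ⟨a, b⟩; exact ⟨b, a, by linarith [hv.2]⟩
  rw [measureReal_restrict_apply measurableSet_Iio, h2]
  simp [hv.1.le]
  module

/-- Tilting a fair sign by `exp (y x)` gives `1` the mass `exp y / (2 cosh y) = (1 + tanh y) / 2`,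
which is the length of the interval where the threshold spin is `1`. -/
lemma map_coupledSpin_successProb (y : ℝ) :
    ((volume : Measure ℝ).restrict (Set.Icc (0 : ℝ) 1)).map
      (fun u => coupledSpin u (successProb y)) = spinLaw.tilted fun x => y * x := by
  have hp : IsProbabilityMeasure (spinLaw.tilted fun x => y * x) :=
    isProbabilityMeasure_tilted (integrable_spinLaw _)
  have hm := measurable_coupledSpin_left (successProb y)
  have := Measure.isProbabilityMeasure_map
    (μ := (volume : Measure ℝ).restrict (Set.Icc (0 : ℝ) 1)) hm.aemeasurable
  refine Measure.ext fun s hs => ?_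
  rw [← ENNReal.toReal_eq_toReal_iff' (measure_ne_top _ _) (measure_ne_top _ _)]
  change Measure.real _ s = Measure.real _ s
  rw [← integral_indicator_one hs, ← integral_indicator_one hs, integral_tilted_spinLaw,
    integral_map hm.aemeasurable
      ((measurable_one.indicator hs).aestronglyMeasurable),
    integral_coupledSpin _ (successProb_mem y)]
  simp

/-- The exponential of a sum factorises, and so does its normalising constant; by Fubini the two
measures agree on boxes. -/
lemma pi_tilted {ι α : Type*} [Fintype ι] [MeasurableSpace α] (μ : Measure α)
    [IsProbabilityMeasure μ] (f : α → ℝ) :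
    Measure.pi (fun _ : ι => μ.tilted f)
      = (Measure.pi fun _ : ι => μ).tilted fun x => ∑ i, f (x i) := by
  refine Measure.pi_eq fun s hs => ?_
  rw [tilted_apply_eq_ofReal_integral' _ (MeasurableSet.univ_pi hs)]
  simp_rw [tilted_apply_eq_ofReal_integral' _ (hs _)]
  rw [← ENNReal.ofReal_prod_of_nonneg fun i _ =>
    integral_nonneg fun x => div_nonneg (exp_pos _).le (integral_nonneg fun x => (exp_pos _).le)]
  congr 1
  simp_rw [← integral_indicator (hs _)]
  rw [← integral_fintype_prod_eq_prod, ← integral_indicator (MeasurableSet.univ_pi hs)]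
  refine integral_congr_ae (Eventually.of_forall fun x => ?_)
  simp only [exp_sum]
  rw [integral_fintype_prod_eq_pow (ι := ι) (fun x => exp (f x))]
  by_cases hx : x ∈ Set.univ.pi s
  · rw [Set.indicator_of_mem hx]
    rw [Finset.prod_congr rfl fun i _ => Set.indicator_of_mem (hx i (Set.mem_univ i)) _,
      Finset.prod_div_distrib, Finset.prod_const, Finset.card_univ]
  · rw [Set.indicator_of_notMem hx]
    simp only [Set.mem_pi, Set.mem_univ, true_imp_iff, not_forall] at hx
    obtain ⟨i, hi⟩ := hx
    exact (Finset.prod_eq_zero (Finset.mem_univ i) (Set.indicator_of_notMem hi _)).symm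

lemma ae_abs_sum_le (n : ℕ) :
    ∀ᵐ x : Fin n → ℝ ∂(Measure.pi fun _ : Fin n => spinLaw), |∑ k, x k| ≤ (n : ℝ) := by
  have h1 : ∀ᵐ x ∂spinLaw, |x| ≤ 1 := by
    rw [spinLaw, bernoulliMeasure_def, ae_add_measure_iff]
    constructor <;> refine Measure.ae_smul_measure ?_ _ <;> rw [ae_dirac_eq] <;> simp
  have h2 : ∀ᵐ x ∂(Measure.pi fun _ : Fin n => spinLaw), ∀ k, |x k| ≤ 1 :=
    ae_all_iff.2 fun k => (Measure.tendsto_eval_ae_ae (μ := fun _ : Fin n => spinLaw)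
      (i := k)).eventually h1
  filter_upwards [h2] with x hx
  calc |∑ k, x k| ≤ ∑ k, |x k| := Finset.abs_sum_le_sum_abs _ _
    _ ≤ ∑ _k : Fin n, 1 := Finset.sum_le_sum fun k _ => hx k
    _ = n := by simp

lemma integrable_exp_sum_sq (n : ℕ) (c : ℝ) :
    Integrable (fun x : Fin n → ℝ => exp (c * (∑ k, x k) ^ 2))
      (Measure.pi fun _ : Fin n => spinLaw) := by
  refine Integrable.mono' (integrable_const (exp (|c| * (n : ℝ) ^ 2)))
    (by fun_prop) ?_
  filter_upwards [ae_abs_sum_le n] with x hx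
  rw [norm_of_nonneg (exp_pos _).le, exp_le_exp]
  have : (∑ k, x k) ^ 2 ≤ (n : ℝ) ^ 2 := by
    rw [← sq_abs (∑ k, x k)]
    exact pow_le_pow_left₀ (abs_nonneg _) hx 2
  calc c * (∑ k, x k) ^ 2 ≤ |c| * (∑ k, x k) ^ 2 := by gcongr; exact le_abs_self c
    _ ≤ _ := by gcongr

instance isProbabilityMeasure_curieWeissMeasure (n : ℕ) (b : ℝ) :
    IsProbabilityMeasure (curieWeissMeasure n b) :=
  isProbabilityMeasure_tilted (integrable_exp_sum_sq n _)

/-- Total mass one forces `C` to be the inverse of the normalising integral, so the Curie-Weiss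
partition function never has to be computed. -/
lemma eq_tilted_of_density {α : Type*} [MeasurableSpace α] {μ m : Measure α}
    [IsProbabilityMeasure m] {g : α → ℝ} {C : ℝ} (hC : 0 ≤ C)
    (hg : Integrable (fun x => exp (g x)) μ)
    (h : ∀ s, MeasurableSet s → m s = ∫⁻ x in s, ENNReal.ofReal (C * exp (g x)) ∂μ) :
    m = μ.tilted g := by
  have h1 := h Set.univ MeasurableSet.univ
  rw [Measure.restrict_univ, measure_univ, ← ofReal_integral_eq_lintegral_ofReal (hg.const_mul C)
    (Eventually.of_forall fun x => mul_nonneg hC (exp_pos _).le), integral_const_mul,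
    eq_comm, ENNReal.ofReal_eq_one] at h1
  have hne : (∫ x, exp (g x) ∂μ) ≠ 0 := fun h0 => by simp [h0] at h1
  ext s hs
  rw [h s hs, tilted_apply' _ _ hs]
  refine lintegral_congr fun x => ?_
  congr 1
  rw [eq_div_iff hne, mul_right_comm, h1, one_mul]

lemma exp_neg_sq_add_mul {a : ℝ} (ha : 0 < a) (s y : ℝ) :
    exp (-a * y ^ 2 + y * s) = exp (s ^ 2 / (4 * a)) * exp (-a * (y - s / (2 * a)) ^ 2) := by
  rw [← exp_add]
  congr 1
  field_simp
  ring

/-- Hubbard-Stratonovich identity: for `a = n / (2b)` the exponent `s² / (4a)` is the Curie-Weiss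
energy `b s² / (2n)`. -/
lemma lintegral_exp_neg_sq_add_mul {a : ℝ} (ha : 0 < a) (s : ℝ) :
    ∫⁻ y : ℝ, ENNReal.ofReal (exp (-a * y ^ 2 + y * s))
      = ENNReal.ofReal (√(π / a) * exp (s ^ 2 / (4 * a))) := by
  simp_rw [exp_neg_sq_add_mul ha]
  rw [← ofReal_integral_eq_lintegral_ofReal
    (((integrable_exp_neg_mul_sq ha).comp_sub_right _).const_mul _)
    (Eventually.of_forall fun x => by positivity), integral_const_mul,
    integral_sub_right_eq_self (fun y => exp (-a * y ^ 2)), integral_gaussian, mul_comm]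

/-- The uniform coupling produces Curie-Weiss spins. -/
lemma map_coupledSpin_eq_curieWeissMeasure {n : ℕ} {b : ℝ} (hn : 0 < n) (hb : 0 < b) :
    ((Measure.pi fun _ : Fin n => (volume : Measure ℝ).restrict (Set.Icc (0 : ℝ) 1)).prod
      (deFinettiMeasure n b)).map (fun q k => coupledSpin (q.1 k) q.2)
      = curieWeissMeasure n b := by
  have := isProbabilityMeasure_fieldLaw hn hb
  have := isProbabilityMeasure_deFinettiMeasure hn hb
  have hn' : (0 : ℝ) < n := by exact_mod_cast hn
  have hm : Measurable fun (q : (Fin n → ℝ) × ℝ) (k : Fin n) => coupledSpin (q.1 k) q.2 :=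
    measurable_pi_lambda _ fun k => measurable_coupledSpin.comp
      (f := fun q : (Fin n → ℝ) × ℝ => (q.1 k, q.2)) (by fun_prop)
  have := Measure.isProbabilityMeasure_map (μ := (Measure.pi fun _ : Fin n =>
    (volume : Measure ℝ).restrict (Set.Icc (0 : ℝ) 1)).prod (deFinettiMeasure n b)) hm.aemeasurable
  set a : ℝ := n / (2 * b) with ha
  have ha0 : 0 < a := by positivity
  set Z := ∫ y, exp (fieldExponent n b y) with hZ
  have hZ0 : 0 ≤ Z := integral_nonneg fun y => (exp_pos _).le
  -- `Z` normalises the field law and `√(π / a)` is the Gaussian integral over the field.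
  refine eq_tilted_of_density (C := √(π / a) / Z) (by positivity) (integrable_exp_sum_sq n _)
    fun s hs => ?_
  rw [Measure.map_apply hm hs, Measure.prod_apply_symm (hm hs), deFinettiMeasure_eq_map,
    lintegral_map (measurable_measure_prodMk_right (hm hs)) continuous_successProb.measurable]
  -- At fixed field the spins are independent tilted signs, of joint density `exp (y S) / cosh y ^
  -- n`.
  have hfib : ∀ y, (Measure.pi fun _ : Fin n => (volume : Measure ℝ).restrict (Set.Icc (0 : ℝ) 1))
      ((fun x => (x, successProb y)) ⁻¹' ((fun (q : (Fin n → ℝ) × ℝ) (k : Fin n) =>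
        coupledSpin (q.1 k) q.2) ⁻¹' s))
      = ∫⁻ x in s, ENNReal.ofReal (exp (y * ∑ k, x k) / cosh y ^ n)
        ∂(Measure.pi fun _ : Fin n => spinLaw) := by
    intro y
    have h1 := Measure.pi_map_pi (μ := fun _ : Fin n =>
      (volume : Measure ℝ).restrict (Set.Icc (0 : ℝ) 1))
      (f := fun _ u => coupledSpin u (successProb y))
      (hμ := fun _ => by rw [map_coupledSpin_successProb]; infer_instance)
      fun _ => (measurable_coupledSpin_left _).aemeasurable
    rw [map_coupledSpin_successProb, pi_tilted] at h1
    have h2 := congrArg (fun μ : Measure (Fin n → ℝ) => μ s) h1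
    have hmy : Measurable fun (x : Fin n → ℝ) (k : Fin n) => coupledSpin (x k) (successProb y) :=
      measurable_pi_lambda _ fun k => (measurable_coupledSpin_left _).comp (measurable_pi_apply k)
    rw [Measure.map_apply hmy hs, tilted_apply' _ _ hs] at h2
    refine h2.trans (lintegral_congr fun x => ?_)
    have h3 : ∫ x : Fin n → ℝ, exp (∑ i, y * x i) ∂(Measure.pi fun _ : Fin n => spinLaw)
        = cosh y ^ n := by
      simp_rw [exp_sum]
      rw [integral_fintype_prod_eq_pow (fun x => exp (y * x)), integral_exp_mul_spinLaw,
        Fintype.card_fin]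
    rw [h3, Finset.mul_sum]
  simp_rw [hfib]
  rw [fieldLaw, lintegral_tilted, ← hZ]
  have hjm : Measurable fun q : ℝ × (Fin n → ℝ) =>
      ENNReal.ofReal (exp (q.1 * ∑ k, q.2 k) / cosh q.1 ^ n) := by fun_prop
  have hin : ∀ y, ENNReal.ofReal (exp (fieldExponent n b y) / Z) *
      ∫⁻ x in s, ENNReal.ofReal (exp (y * ∑ k, x k) / cosh y ^ n)
        ∂(Measure.pi fun _ : Fin n => spinLaw)
      = ∫⁻ x in s, ENNReal.ofReal (exp (fieldExponent n b y) / Z) *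
        ENNReal.ofReal (exp (y * ∑ k, x k) / cosh y ^ n)
        ∂(Measure.pi fun _ : Fin n => spinLaw) :=
    fun y => (lintegral_const_mul _ (by fun_prop)).symm
  simp_rw [hin]
  have hfm := (continuous_fieldExponent n b).measurable
  -- After Tonelli, `cosh y ^ n` in the field density cancels the normalisation of the tilted spins,
  -- leaving a Gaussian integral in `y`.
  rw [lintegral_lintegral_swap]
  · refine lintegral_congr fun x => ?_
    have h4 : ∀ y, ENNReal.ofReal (exp (fieldExponent n b y) / Z)
        * ENNReal.ofReal (exp (y * ∑ k, x k) / cosh y ^ n)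
        = ENNReal.ofReal Z⁻¹ * ENNReal.ofReal (exp (-a * y ^ 2 + y * ∑ k, x k)) := by
      intro y
      rw [← ENNReal.ofReal_mul (by positivity), ← ENNReal.ofReal_mul (by positivity)]
      congr 1
      have h5 : exp (fieldExponent n b y) = exp (-a * y ^ 2) * cosh y ^ n := by
        rw [fieldExponent, exp_add, exp_nat_mul, exp_log (cosh_pos y)]
      have := (cosh_pos y).ne'
      rw [h5, exp_add]
      field_simp
    simp_rw [h4]
    rw [lintegral_const_mul _ (by fun_prop), lintegral_exp_neg_sq_add_mul ha0,
      ← ENNReal.ofReal_mul (by positivity)]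
    congr 1
    have h6 : (∑ k, x k) ^ 2 / (4 * a) = b / (2 * n) * (∑ k, x k) ^ 2 := by
      rw [ha]; field_simp; ring
    rw [h6]
    ring
  · refine (Measurable.mul ?_ hjm).aemeasurable
    exact ENNReal.measurable_ofReal.comp
      ((measurable_exp.comp (hfm.comp measurable_fst)).div_const _)

/-! ### Scaling limit of the field in the critical window. -/

lemma rpow_quarter_pow_four (n : ℕ) : ((n : ℝ) ^ (1 / 4 : ℝ)) ^ 4 = n := by
  rw [← rpow_natCast, ← rpow_mul (Nat.cast_nonneg n)]
  norm_num

lemma rpow_quarter_sq (n : ℕ) : ((n : ℝ) ^ (1 / 4 : ℝ)) ^ 2 = √(n : ℝ) := by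
  rw [← rpow_natCast, ← rpow_mul (Nat.cast_nonneg n), sqrt_eq_rpow]
  norm_num

lemma rpow_quarter_cube (n : ℕ) : ((n : ℝ) ^ (1 / 4 : ℝ)) ^ 3 = (n : ℝ) ^ (3 / 4 : ℝ) := by
  rw [← rpow_natCast, ← rpow_mul (Nat.cast_nonneg n)]
  norm_num

lemma rpow_quarter_pos {n : ℕ} (hn : 0 < n) : 0 < (n : ℝ) ^ (1 / 4 : ℝ) :=
  rpow_pos_of_pos (by exact_mod_cast hn) _

lemma tendsto_rpow_quarter : Tendsto (fun n : ℕ => (n : ℝ) ^ (1 / 4 : ℝ)) atTop atTop :=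
  (tendsto_rpow_atTop (by norm_num)).comp tendsto_natCast_atTop_atTop

lemma tendsto_sqrt_nat : Tendsto (fun n : ℕ => √(n : ℝ)) atTop atTop :=
  tendsto_sqrt_atTop.comp tendsto_natCast_atTop_atTop

/-- In the critical window the rescaled field exponent is a quadratic term with bounded coefficient
minus the rescaled defect of `log cosh`. -/
lemma fieldExponent_rescale {n : ℕ} {b γ : ℝ} (hn : 0 < n) (hb : 0 < b) (h : b = 1 - γ / √(n : ℝ))
    (x : ℝ) :
    fieldExponent n b (x / (n : ℝ) ^ (1 / 4 : ℝ)) = -(γ / b) * (x ^ 2 / 2)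
      - n * ((x / (n : ℝ) ^ (1 / 4 : ℝ)) ^ 2 / 2 - log (cosh (x / (n : ℝ) ^ (1 / 4 : ℝ)))) := by
  rw [← rpow_quarter_sq] at h
  have h4 := rpow_quarter_pow_four n
  have hr := rpow_quarter_pos hn
  set r := (n : ℝ) ^ (1 / 4 : ℝ)
  have hγ : γ = (1 - b) * r ^ 2 := by rw [h]; field_simp; ring
  rw [fieldExponent, hγ, ← h4]
  field_simp
  ring

lemma tendsto_beta {γ : ℝ} {β : ℕ → ℝ} (hβ : ∀ n : ℕ, 0 < n → β n = 1 - γ / √(n : ℝ)) :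
    Tendsto β atTop (𝓝 1) := by
  have : Tendsto (fun n : ℕ => 1 - γ / √(n : ℝ)) atTop (𝓝 (1 - 0)) :=
    tendsto_const_nhds.sub (tendsto_const_nhds.div_atTop tendsto_sqrt_nat)
  rw [sub_zero] at this
  refine this.congr' ?_
  filter_upwards [eventually_gt_atTop 0] with n hn using (hβ n hn).symm

lemma eventually_beta_pos {γ : ℝ} {β : ℕ → ℝ} (hβ : ∀ n : ℕ, 0 < n → β n = 1 - γ / √(n : ℝ)) :
    ∀ᶠ n in atTop, 0 < n ∧ 0 < β n :=
  (eventually_gt_atTop 0).and ((tendsto_beta hβ).eventually (eventually_gt_nhds one_pos))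

/-- After clearing denominators the difference is `(r² - R)(x⁴ - R x² + R²) + R³`. With `r² = √n`,
the coefficient `R` can be taken as large as desired once `n` is large. -/
lemma quartic_lower_bound {r : ℝ} (R x : ℝ) (hr : 0 < r) (hR : 0 ≤ R) (h : R ≤ r ^ 2) :
    R * x ^ 2 - R ^ 2 ≤ r ^ 4 * ((x / r) ^ 4 / (1 + (x / r) ^ 2)) := by
  have e : r ^ 4 * ((x / r) ^ 4 / (1 + (x / r) ^ 2)) = x ^ 4 * r ^ 2 / (r ^ 2 + x ^ 2) := by
    field_simp
  rw [e, le_div_iff₀ (by positivity)]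
  have h1 : 0 ≤ x ^ 4 * (r ^ 2 - R) := mul_nonneg (by positivity) (by linarith)
  have h2 : 0 ≤ R * x ^ 2 * (r ^ 2 - R) := by
    have := sub_nonneg.2 h
    positivity
  nlinarith [sq_nonneg (R * r), sq_nonneg (x ^ 2 - R), sq_nonneg x, sq_nonneg r,
    mul_nonneg (sq_nonneg x) (sq_nonneg x), mul_nonneg hR (sq_nonneg x)]

/-- The defect of `log cosh` is squeezed between its two quartic bounds; as `(n^(1/4))⁴ = n`, both
tend to `x⁴ / 12`. -/
lemma tendsto_fieldExponent_rescale {γ : ℝ} {β : ℕ → ℝ}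
    (hβ : ∀ n : ℕ, 0 < n → β n = 1 - γ / √(n : ℝ)) (x : ℝ) :
    Tendsto (fun n : ℕ => fieldExponent n (β n) (x / (n : ℝ) ^ (1 / 4 : ℝ))) atTop
      (𝓝 (-(x ^ 4 / 12) - γ * (x ^ 2 / 2))) := by
  have h0 : Tendsto (fun n : ℕ => x / (n : ℝ) ^ (1 / 4 : ℝ)) atTop (𝓝 0) :=
    tendsto_const_nhds.div_atTop tendsto_rpow_quarter
  have hdef : Tendsto (fun n : ℕ => (n : ℝ) * ((x / (n : ℝ) ^ (1 / 4 : ℝ)) ^ 2 / 2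
      - log (cosh (x / (n : ℝ) ^ (1 / 4 : ℝ))))) atTop (𝓝 (x ^ 4 / 12)) := by
    have hlow : Tendsto (fun n : ℕ => x ^ 4 / (1 + (x / (n : ℝ) ^ (1 / 4 : ℝ)) ^ 2) / 12) atTop
        (𝓝 (x ^ 4 / 12)) := by
      have h1 : Tendsto (fun n : ℕ => 1 + (x / (n : ℝ) ^ (1 / 4 : ℝ)) ^ 2) atTop
          (𝓝 (1 + 0 ^ 2)) := (h0.pow 2).const_add 1
      have := ((tendsto_const_nhds (x := x ^ 4)).div h1 (by norm_num)).div_const 12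
      simpa using this
    refine tendsto_of_tendsto_of_tendsto_of_le_of_le' hlow tendsto_const_nhds ?_ ?_
    all_goals
      filter_upwards [eventually_gt_atTop 0] with n hn
      have h4 := rpow_quarter_pow_four n
      have hr := rpow_quarter_pos hn
      set r := (n : ℝ) ^ (1 / 4 : ℝ)
      rw [← h4]
    · have := mul_le_mul_of_nonneg_left (le_half_sq_sub_log_cosh (x / r)) (pow_nonneg hr.le 4)
      refine le_trans (le_of_eq ?_) this
      field_simp
    · have := mul_le_mul_of_nonneg_left (half_sq_sub_log_cosh_le (x / r)) (pow_nonneg hr.le 4)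
      refine le_trans this (le_of_eq ?_)
      field_simp
  have hcoef : Tendsto (fun n => -(γ / β n) * (x ^ 2 / 2)) atTop (𝓝 (-(γ / 1) * (x ^ 2 / 2))) :=
    ((tendsto_const_nhds.div (tendsto_beta hβ) one_ne_zero).neg).mul_const _
  have := hcoef.sub hdef
  rw [show -(γ / 1) * (x ^ 2 / 2) - x ^ 4 / 12 = -(x ^ 4 / 12) - γ * (x ^ 2 / 2) by ring] at this
  refine this.congr' ?_
  filter_upwards [eventually_beta_pos hβ] with n hn
  exact (fieldExponent_rescale hn.1 hn.2 (hβ n hn.1) x).symm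

/-- Domination uniform in `n`: the quartic term must beat the quadratic one, which has the wrong
sign when `γ < 0`. -/
lemma fieldExponent_rescale_le {γ : ℝ} {β : ℕ → ℝ}
    (hβ : ∀ n : ℕ, 0 < n → β n = 1 - γ / √(n : ℝ)) :
    ∃ C : ℝ, ∀ᶠ n : ℕ in atTop, ∀ x : ℝ,
      fieldExponent n (β n) (x / (n : ℝ) ^ (1 / 4 : ℝ)) ≤ C - x ^ 2 := by
  set K := |γ| + 1
  have hK : 0 < K := by positivity
  -- Chosen so that `R x² / 12 = K x² / 2 + x²`: one part pays for the quadratic term, whose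
  -- coefficient is eventually below `K`, and `x²` is left over.
  set R := 6 * K + 12
  refine ⟨R ^ 2 / 12, ?_⟩
  have h1 : Tendsto (fun n => |γ / β n|) atTop (𝓝 |γ / 1|) :=
    (tendsto_const_nhds.div (tendsto_beta hβ) one_ne_zero).abs
  have h2 : ∀ᶠ n in atTop, |γ / β n| < K :=
    h1.eventually (eventually_lt_nhds (by rw [div_one]; exact lt_add_one _))
  filter_upwards [eventually_beta_pos hβ, h2, tendsto_sqrt_nat.eventually_ge_atTop R]
    with n hn hγ hR x
  rw [fieldExponent_rescale hn.1 hn.2 (hβ n hn.1)]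
  rw [← rpow_quarter_sq] at hR
  have h4 := rpow_quarter_pow_four n
  have hr := rpow_quarter_pos hn.1
  set r := (n : ℝ) ^ (1 / 4 : ℝ)
  rw [← h4]
  have h5 := mul_le_mul_of_nonneg_left (le_half_sq_sub_log_cosh (x / r)) (pow_nonneg hr.le 4)
  have h6 := quartic_lower_bound R x hr (by positivity) hR
  have h7 : -(γ / β n) * (x ^ 2 / 2) ≤ K * (x ^ 2 / 2) := by
    gcongr
    exact (neg_le_abs _).trans hγ.le
  have h8 : R * x ^ 2 = 6 * K * x ^ 2 + 12 * x ^ 2 := by ring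
  linarith

lemma integrable_exp_sub_sq (C : ℝ) : Integrable fun x : ℝ => exp (C - x ^ 2) := by
  have := (integrable_exp_neg_mul_sq (one_pos)).const_mul (exp C)
  refine this.congr (Eventually.of_forall fun x => ?_)
  simp only [← exp_add]
  congr 1; ring

lemma integrable_exp_limit (γ : ℝ) :
    Integrable fun x : ℝ => exp (-(x ^ 4 / 12) - γ * (x ^ 2 / 2)) := by
  -- With `R = 6 |γ| + 12`, completing the square gives `x⁴ / 12 ≥ R x² / 12 - R² / 48`.
  refine Integrable.mono' (integrable_exp_sub_sq ((6 * |γ| + 12) ^ 2 / 48)) (by fun_prop)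
    (Eventually.of_forall fun x => ?_)
  rw [norm_of_nonneg (exp_pos _).le, exp_le_exp]
  have h : -γ * (x ^ 2 / 2) ≤ |γ| * (x ^ 2 / 2) := by gcongr; exact neg_le_abs γ
  nlinarith [sq_nonneg (x ^ 2 - (6 * |γ| + 12) / 2)]

instance isProbabilityMeasure_limitLaw (γ : ℝ) : IsProbabilityMeasure (limitLaw γ) :=
  isProbabilityMeasure_tilted (integrable_exp_limit γ)

/-- The test function may depend on `n`, beyond what weak convergence allows: it will contain the
conditional characteristic function of the spins. -/
lemma tendsto_integral_exp_fieldExponent {γ : ℝ} {β : ℕ → ℝ}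
    (hβ : ∀ n : ℕ, 0 < n → β n = 1 - γ / √(n : ℝ)) {Φ : ℕ → ℝ → ℂ} {Ψ : ℝ → ℂ}
    (hm : ∀ n, Measurable (Φ n)) (hb : ∀ n x, ‖Φ n x‖ ≤ 1)
    (hlim : ∀ x, Tendsto (fun n => Φ n x) atTop (𝓝 (Ψ x))) :
    Tendsto (fun n : ℕ => ∫ x, exp (fieldExponent n (β n) (x / (n : ℝ) ^ (1 / 4 : ℝ))) • Φ n x)
      atTop (𝓝 (∫ x, exp (-(x ^ 4 / 12) - γ * (x ^ 2 / 2)) • Ψ x)) := by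
  obtain ⟨C, hC⟩ := fieldExponent_rescale_le hβ
  refine tendsto_integral_filter_of_dominated_convergence (fun x => exp (C - x ^ 2)) ?_ ?_
    (integrable_exp_sub_sq C) (Eventually.of_forall fun x => ?_)
  · refine Eventually.of_forall fun n => ?_
    have h : Measurable fun x : ℝ =>
        exp (fieldExponent n (β n) (x / (n : ℝ) ^ (1 / 4 : ℝ))) :=
      measurable_exp.comp ((continuous_fieldExponent n (β n)).measurable.comp (by fun_prop))
    exact (h.smul (hm n)).aestronglyMeasurable
  · filter_upwards [hC] with n hn
    refine Eventually.of_forall fun x => ?_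
    rw [norm_smul, norm_of_nonneg (exp_pos _).le]
    calc _ ≤ exp (C - x ^ 2) * 1 :=
          mul_le_mul (exp_le_exp.2 (hn x)) (hb n x) (norm_nonneg _) (exp_pos _).le
      _ = _ := mul_one _
  · exact (continuous_exp.continuousAt.tendsto.comp (tendsto_fieldExponent_rescale hβ x)).smul
      (hlim x)

lemma integral_tilted_eq_smul {α : Type*} [MeasurableSpace α] (μ : Measure α) (f : α → ℝ)
    (g : α → ℂ) :
    ∫ x, g x ∂μ.tilted f = (∫ x, exp (f x) ∂μ)⁻¹ • ∫ x, exp (f x) • g x ∂μ := by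
  rw [integral_tilted, ← integral_smul]
  refine integral_congr_ae (Eventually.of_forall fun x => ?_)
  simp only [smul_smul, div_eq_inv_mul]

lemma integral_fieldLaw_rescale {n : ℕ} (hn : 0 < n) (b : ℝ) (g : ℝ → ℂ) :
    ∫ y, g y ∂fieldLaw n b
      = (∫ x, exp (fieldExponent n b (x / (n : ℝ) ^ (1 / 4 : ℝ))))⁻¹ •
        ∫ x, exp (fieldExponent n b (x / (n : ℝ) ^ (1 / 4 : ℝ))) •
          g (x / (n : ℝ) ^ (1 / 4 : ℝ)) := by
  have hr := rpow_quarter_pos hn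
  rw [fieldLaw, integral_tilted_eq_smul,
    Measure.integral_comp_div (fun y => exp (fieldExponent n b y)),
    Measure.integral_comp_div (fun y => exp (fieldExponent n b y) • g y), abs_of_pos hr,
    smul_smul, smul_eq_mul, mul_inv, mul_right_comm, inv_mul_cancel₀ hr.ne', one_mul]

/-- Convergence of the rescaled random field to the quartic law, tested against uniformly bounded
pointwise convergent functions. -/
lemma tendsto_integral_fieldLaw {γ : ℝ} {β : ℕ → ℝ}
    (hβ : ∀ n : ℕ, 0 < n → β n = 1 - γ / √(n : ℝ)) {Φ : ℕ → ℝ → ℂ} {Ψ : ℝ → ℂ}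
    (hm : ∀ n, Measurable (Φ n)) (hb : ∀ n x, ‖Φ n x‖ ≤ 1)
    (hlim : ∀ x, Tendsto (fun n : ℕ => Φ n (x / (n : ℝ) ^ (1 / 4 : ℝ))) atTop (𝓝 (Ψ x))) :
    Tendsto (fun n : ℕ => ∫ y, Φ n y ∂fieldLaw n (β n)) atTop (𝓝 (∫ x, Ψ x ∂limitLaw γ)) := by
  have hnum := tendsto_integral_exp_fieldExponent hβ
    (Φ := fun n x => Φ n (x / (n : ℝ) ^ (1 / 4 : ℝ))) (Ψ := Ψ)
    (fun n => (hm n).comp (by fun_prop)) (fun n x => hb n _) hlim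
  -- The normalising constants converge by the case of the constant test function `1`.
  have hden := tendsto_integral_exp_fieldExponent hβ (Φ := fun _ _ => 1) (Ψ := fun _ => 1)
    (fun n => measurable_const) (fun n x => by simp) (fun x => tendsto_const_nhds)
  have hden' : Tendsto (fun n : ℕ =>
      ∫ x, exp (fieldExponent n (β n) (x / (n : ℝ) ^ (1 / 4 : ℝ)))) atTop
      (𝓝 (∫ x, exp (-(x ^ 4 / 12) - γ * (x ^ 2 / 2)))) := by
    have hre := (Complex.continuous_re.tendsto _).comp hden
    have e : ∀ f : ℝ → ℝ, (∫ x, f x • (1 : ℂ)) = ((∫ x, f x : ℝ) : ℂ) := fun f => by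
      rw [← integral_complex_ofReal]; simp
    simp only [e, Function.comp_def, Complex.ofReal_re] at hre
    exact hre
  have hne : (∫ x, exp (-(x ^ 4 / 12) - γ * (x ^ 2 / 2))) ≠ 0 :=
    (integral_exp_pos (integrable_exp_limit γ)).ne'
  rw [limitLaw, integral_tilted_eq_smul]
  refine ((hden'.inv₀ hne).smul hnum).congr' ?_
  filter_upwards [eventually_gt_atTop 0] with n hn
  exact (integral_fieldLaw_rescale hn (β n) (Φ n)).symm

/-! ### Conditional central limit theorem given the field. -/

/-- The characteristic function at `u` of a spin of mean `T`, centred. -/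
def centredSpinChar (T u : ℝ) : ℂ :=
  ((1 + T) / 2 : ℝ) • Complex.exp ((u * (1 - T) : ℝ) * Complex.I)
    + ((1 - T) / 2 : ℝ) • Complex.exp ((u * (-1 - T) : ℝ) * Complex.I)

lemma norm_centredSpinChar_le {T : ℝ} (h1 : -1 ≤ T) (h2 : T ≤ 1) (u : ℝ) :
    ‖centredSpinChar T u‖ ≤ 1 := by
  refine (norm_add_le _ _).trans ?_
  rw [norm_smul, norm_smul, Complex.norm_exp_ofReal_mul_I, Complex.norm_exp_ofReal_mul_I,
    norm_of_nonneg (by linarith), norm_of_nonneg (by linarith)]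
  linarith

lemma norm_exp_sub_taylor_le {z : ℝ} (hz : |z| ≤ 1) :
    ‖Complex.exp (z * Complex.I) - (1 + z * Complex.I - z ^ 2 / 2)‖ ≤ |z| ^ 3 := by
  have hn : ‖(z : ℂ) * Complex.I‖ = |z| := by simp
  have h := Complex.exp_bound (x := (z : ℂ) * Complex.I) (by rw [hn]; exact hz)
    (n := 3) (by norm_num)
  rw [hn] at h
  have e : ∑ m ∈ Finset.range 3, ((z : ℂ) * Complex.I) ^ m / (m.factorial : ℂ)
      = 1 + z * Complex.I - z ^ 2 / 2 := by
    simp [Finset.sum_range_succ, mul_pow, Nat.factorial]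
    ring
  rw [e] at h
  refine h.trans ?_
  have : (0 : ℝ) ≤ |z| ^ 3 := by positivity
  norm_num [Nat.factorial]
  linarith

/-- The centred spin has mean `0` and variance `1 - T²`. Its values `±1 - T` are at most `2` in
modulus, whence `8 = 2³` and the range `|u| ≤ 1/2`, which keeps the Taylor argument in `[-1, 1]`. -/
lemma norm_centredSpinChar_sub_le {T : ℝ} (h1 : -1 ≤ T) (h2 : T ≤ 1) {u : ℝ} (hu : |u| ≤ 1 / 2) :
    ‖centredSpinChar T u - (1 - (u ^ 2 * (1 - T ^ 2) / 2 : ℝ))‖ ≤ 8 * |u| ^ 3 := by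
  have key : ∀ c : ℝ, |c| ≤ 2 → ‖Complex.exp ((u * c : ℝ) * Complex.I)
      - (1 + (u * c : ℝ) * Complex.I - ((u * c : ℝ) : ℂ) ^ 2 / 2)‖ ≤ 8 * |u| ^ 3 := by
    intro c hc
    have hm : |u * c| ≤ |u| * 2 := by rw [abs_mul]; gcongr
    refine (norm_exp_sub_taylor_le (by linarith)).trans ?_
    calc |u * c| ^ 3 ≤ (|u| * 2) ^ 3 := by gcongr
      _ = _ := by ring
  have k1 := key (1 - T) (abs_le.2 ⟨by linarith, by linarith⟩)
  have k2 := key (-1 - T) (abs_le.2 ⟨by linarith, by linarith⟩)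
  have e : centredSpinChar T u - (1 - (u ^ 2 * (1 - T ^ 2) / 2 : ℝ))
      = ((1 + T) / 2 : ℝ) • (Complex.exp ((u * (1 - T) : ℝ) * Complex.I)
        - (1 + (u * (1 - T) : ℝ) * Complex.I - ((u * (1 - T) : ℝ) : ℂ) ^ 2 / 2))
      + ((1 - T) / 2 : ℝ) • (Complex.exp ((u * (-1 - T) : ℝ) * Complex.I)
        - (1 + (u * (-1 - T) : ℝ) * Complex.I - ((u * (-1 - T) : ℝ) : ℂ) ^ 2 / 2)) := by
    rw [centredSpinChar]
    simp only [Complex.real_smul]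
    push_cast
    ring
  rw [e]
  refine (norm_add_le _ _).trans ?_
  rw [norm_smul, norm_smul, norm_of_nonneg (by linarith), norm_of_nonneg (by linarith)]
  calc _ ≤ (1 + T) / 2 * (8 * |u| ^ 3) + (1 - T) / 2 * (8 * |u| ^ 3) :=
        add_le_add (mul_le_mul_of_nonneg_left k1 (by linarith))
          (mul_le_mul_of_nonneg_left k2 (by linarith))
    _ = _ := by ring

/-- Since `T n → 0` the variance tends to `1`, so `n (φ - 1) → -s²/2` and `φ ^ n → exp (-s²/2)`. The
frequency `σ n` varies so that the case `σ n = t / n^(1/4)`, used for the magnetisation, is covered.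
-/
lemma tendsto_centredSpinChar_pow {s : ℝ} {σ T : ℕ → ℝ} (hσ : Tendsto σ atTop (𝓝 s))
    (hT : Tendsto T atTop (𝓝 0)) (h1 : ∀ n, -1 ≤ T n) (h2 : ∀ n, T n ≤ 1) :
    Tendsto (fun n : ℕ => centredSpinChar (T n) (σ n / √(n : ℝ)) ^ n) atTop
      (𝓝 (Complex.exp (-(s ^ 2 / 2 : ℝ)))) := by
  have hu : Tendsto (fun n : ℕ => σ n / √(n : ℝ)) atTop (𝓝 0) := hσ.div_atTop tendsto_sqrt_nat
  have hmain : Tendsto (fun n : ℕ => (n : ℂ) * (centredSpinChar (T n) (σ n / √(n : ℝ)) - 1)) atTop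
      (𝓝 (-(s ^ 2 / 2 : ℝ) : ℂ)) := by
    have hq : Tendsto (fun n : ℕ => ((-(σ n ^ 2 * (1 - T n ^ 2) / 2) : ℝ) : ℂ)) atTop
        (𝓝 ((-(s ^ 2 * (1 - 0 ^ 2) / 2) : ℝ) : ℂ)) :=
      (Complex.continuous_ofReal.tendsto _).comp
        ((((hσ.pow 2).mul ((hT.pow 2).const_sub 1)).div_const 2).neg)
    have hrem : Tendsto (fun n : ℕ => (n : ℂ) * (centredSpinChar (T n) (σ n / √(n : ℝ)) - 1)
        - ((-(σ n ^ 2 * (1 - T n ^ 2) / 2) : ℝ) : ℂ)) atTop (𝓝 0) := by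
      have hbd : Tendsto (fun n : ℕ => 8 * (σ n ^ 2 * |σ n / √(n : ℝ)|)) atTop
          (𝓝 (8 * (s ^ 2 * |0|))) := ((hσ.pow 2).mul hu.abs).const_mul 8
      rw [abs_zero, mul_zero, mul_zero] at hbd
      refine squeeze_zero_norm' ?_ hbd
      have hsmall : ∀ᶠ n : ℕ in atTop, |σ n / √(n : ℝ)| < 1 / 2 :=
        hu.abs.eventually (eventually_lt_nhds (by norm_num))
      filter_upwards [eventually_gt_atTop 0, hsmall] with n hn hs
      have hn' : (0 : ℝ) < n := by exact_mod_cast hn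
      have hsq : (n : ℝ) * (σ n / √(n : ℝ)) ^ 2 = σ n ^ 2 := by
        rw [div_pow, sq_sqrt hn'.le]
        field_simp
      have hb := norm_centredSpinChar_sub_le (h1 n) (h2 n) hs.le
      set u := σ n / √(n : ℝ)
      have e : (n : ℂ) * (centredSpinChar (T n) u - 1)
          - ((-(σ n ^ 2 * (1 - T n ^ 2) / 2) : ℝ) : ℂ)
          = (n : ℂ) * (centredSpinChar (T n) u - (1 - (u ^ 2 * (1 - T n ^ 2) / 2 : ℝ))) := by
        rw [← hsq]
        push_cast
        ring
      rw [e, norm_mul, Complex.norm_natCast, ← hsq]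
      calc (n : ℝ) * _ ≤ n * (8 * |u| ^ 3) := by gcongr
        _ = _ := by rw [← sq_abs u]; ring
    have := hrem.add hq
    simpa using this
  have := Complex.tendsto_one_add_pow_exp_of_tendsto hmain
  simpa using this

/-- This is the derivative of `tanh` at `0`, equal to `1`. -/
lemma tendsto_mul_tanh (x : ℝ) :
    Tendsto (fun n : ℕ => (n : ℝ) ^ (1 / 4 : ℝ) * tanh (x / (n : ℝ) ^ (1 / 4 : ℝ))) atTop
      (𝓝 x) := by
  have h := (hasDerivAt_tanh 0).hasFDerivAt.lim x (l := atTop)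
    (c := fun n : ℕ => (n : ℝ) ^ (1 / 4 : ℝ)) (tendsto_norm_atTop_atTop.comp tendsto_rpow_quarter)
  simpa [div_eq_inv_mul] using h

/-- The limit of the joint characteristic function, in terms of the random field. -/
lemma tendsto_integral_centredSpinChar {γ : ℝ} {β : ℕ → ℝ}
    (hβ : ∀ n : ℕ, 0 < n → β n = 1 - γ / √(n : ℝ)) {s : ℝ} {σ : ℕ → ℝ}
    (hσ : Tendsto σ atTop (𝓝 s)) (t : ℝ) :
    Tendsto (fun n : ℕ => ∫ y, centredSpinChar (tanh y) (σ n / √(n : ℝ)) ^ n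
        * Complex.exp ((t * ((n : ℝ) ^ (1 / 4 : ℝ) * tanh y) : ℝ) * Complex.I) ∂fieldLaw n (β n))
      atTop (𝓝 (Complex.exp (-(s ^ 2 / 2 : ℝ)) * charFun (limitLaw γ) t)) := by
  have htanh : Continuous tanh :=
    continuous_iff_continuousAt.2 fun y => (hasDerivAt_tanh y).continuousAt
  rw [charFun_apply_real, ← integral_const_mul]
  refine tendsto_integral_fieldLaw hβ (fun n => ?_) (fun n y => ?_) fun x => ?_
  · unfold centredSpinChar
    simp only [Complex.real_smul]
    exact Continuous.measurable (by fun_prop)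
  · rw [norm_mul, Complex.norm_exp_ofReal_mul_I, mul_one, norm_pow]
    exact pow_le_one₀ (norm_nonneg _)
      (norm_centredSpinChar_le (neg_one_lt_tanh y).le (tanh_lt_one y).le _)
  -- At field `x / n^(1/4)` the first factor has a limit free of `x`; this is the asymptotic
  -- independence.
  · refine Tendsto.mul (tendsto_centredSpinChar_pow hσ ?_ (fun n => (neg_one_lt_tanh _).le)
      fun n => (tanh_lt_one _).le) ?_
    · have h0 : Tendsto (fun n : ℕ => x / (n : ℝ) ^ (1 / 4 : ℝ)) atTop (𝓝 0) :=
        tendsto_const_nhds.div_atTop tendsto_rpow_quarter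
      simpa [Function.comp_def] using (htanh.tendsto 0).comp h0
    · have h := (tendsto_mul_tanh x).const_mul t
      have hc : Continuous fun z : ℝ => Complex.exp ((z : ℂ) * Complex.I) := by fun_prop
      have := (hc.tendsto (t * x)).comp h
      simpa [Function.comp_def] using this

/-! ### Joint characteristic function in the uniform coupling. -/

/-- The rescaled fluctuation of the magnetisation around its conditional mean, and the rescaled
mixing variable, in terms of the uniform variables and of the success probability. -/
def rescaledPair {n : ℕ} (u : Fin n → ℝ) (v : ℝ) : ℝ × ℝ :=
  ((n : ℝ) ^ (1 / 4 : ℝ) * ((∑ k, coupledSpin (u k) v) / (n : ℝ) ^ (3 / 4 : ℝ)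
      - (n : ℝ) ^ (1 / 4 : ℝ) * (2 * v - 1)),
    (n : ℝ) ^ (1 / 4 : ℝ) * (2 * v - 1))

lemma measurable_rescaledPair (n : ℕ) :
    Measurable fun q : (Fin n → ℝ) × ℝ => rescaledPair q.1 q.2 := by
  have hk : ∀ k : Fin n, Measurable fun q : (Fin n → ℝ) × ℝ => coupledSpin (q.1 k) q.2 :=
    fun k => measurable_coupledSpin.comp (f := fun q : (Fin n → ℝ) × ℝ => (q.1 k, q.2))
      (by fun_prop)
  unfold rescaledPair
  fun_prop

/-- The powers combine to `n^(1/4) / n^(3/4) = 1 / √n`, exhibiting a normalised sum of conditionally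
centred spins. -/
lemma rescaledPair_fst {n : ℕ} (hn : 0 < n) (u : Fin n → ℝ) (v : ℝ) :
    (rescaledPair u v).1 = (∑ k, (coupledSpin (u k) v - (2 * v - 1))) / √(n : ℝ) := by
  rw [rescaledPair, ← rpow_quarter_sq, ← rpow_quarter_cube, Finset.sum_sub_distrib]
  simp only [Finset.sum_const, Finset.card_univ, Fintype.card_fin, nsmul_eq_mul]
  have h4 := rpow_quarter_pow_four n
  have hr := rpow_quarter_pos hn
  set r := (n : ℝ) ^ (1 / 4 : ℝ)
  rw [← h4]
  field_simp

/-- The joint characteristic function of the rescaled pair in the uniform coupling. -/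
lemma integral_exp_rescaledPair {n : ℕ} {b : ℝ} (hn : 0 < n) (hb : 0 < b) (s t : ℝ) :
    ∫ q, Complex.exp ((s * (rescaledPair q.1 q.2).1 + t * (rescaledPair q.1 q.2).2 : ℝ)
        * Complex.I) ∂((Measure.pi fun _ : Fin n =>
          (volume : Measure ℝ).restrict (Set.Icc (0 : ℝ) 1)).prod (deFinettiMeasure n b))
      = ∫ y, centredSpinChar (tanh y) (s / √(n : ℝ)) ^ n
        * Complex.exp ((t * ((n : ℝ) ^ (1 / 4 : ℝ) * tanh y) : ℝ) * Complex.I)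
        ∂fieldLaw n b := by
  have := isProbabilityMeasure_fieldLaw hn hb
  have := isProbabilityMeasure_deFinettiMeasure hn hb
  have hmeas : Measurable fun q : (Fin n → ℝ) × ℝ => Complex.exp
      ((s * (rescaledPair q.1 q.2).1 + t * (rescaledPair q.1 q.2).2 : ℝ) * Complex.I) := by
    have h := measurable_rescaledPair n
    exact Complex.measurable_exp.comp ((Complex.measurable_ofReal.comp
      ((h.fst.const_mul s).add (h.snd.const_mul t))).mul_const _)
  have hint : Integrable (fun q : (Fin n → ℝ) × ℝ => Complex.exp
      ((s * (rescaledPair q.1 q.2).1 + t * (rescaledPair q.1 q.2).2 : ℝ) * Complex.I))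
      ((Measure.pi fun _ : Fin n =>
          (volume : Measure ℝ).restrict (Set.Icc (0 : ℝ) 1)).prod (deFinettiMeasure n b)) :=
    Integrable.of_bound hmeas.aestronglyMeasurable 1
      (Eventually.of_forall fun q => (Complex.norm_exp_ofReal_mul_I _).le)
  rw [integral_prod_symm _ hint, deFinettiMeasure_eq_map, integral_map
    continuous_successProb.aemeasurable
    (hmeas.stronglyMeasurable.integral_prod_left').aestronglyMeasurable]
  refine integral_congr_ae (Eventually.of_forall fun y => ?_)
  simp only
  have hsplit : ∀ u : Fin n → ℝ, Complex.exp ((s * (rescaledPair u (successProb y)).1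
      + t * (rescaledPair u (successProb y)).2 : ℝ) * Complex.I)
      = (∏ k, Complex.exp ((s / √(n : ℝ) * (coupledSpin (u k) (successProb y) - tanh y) : ℝ)
          * Complex.I))
        * Complex.exp ((t * ((n : ℝ) ^ (1 / 4 : ℝ) * tanh y) : ℝ) * Complex.I) := by
    intro u
    rw [rescaledPair_fst hn, rescaledPair, two_mul_successProb_sub_one, ← Complex.exp_sum,
      ← Complex.exp_add, ← Finset.sum_mul, ← add_mul, ← Complex.ofReal_sum, ← Complex.ofReal_add,
      ← Finset.mul_sum]
    congr 4
    ring
  simp_rw [hsplit]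
  rw [integral_mul_const, integral_fintype_prod_eq_pow (fun u => Complex.exp
    ((s / √(n : ℝ) * (coupledSpin u (successProb y) - tanh y) : ℝ) * Complex.I)),
    Fintype.card_fin, integral_coupledSpin (fun x => Complex.exp
      ((s / √(n : ℝ) * (x - tanh y) : ℝ) * Complex.I)) (successProb_mem y), centredSpinChar]
  congr 4
  unfold successProb
  ring

lemma IsUniformCoupling.hasLaw_prod {Ω : Type*} [MeasurableSpace Ω] {n : ℕ} {b : ℝ}
    {U : Fin n → Ω → ℝ} {V : Ω → ℝ} {P : Measure Ω} [IsProbabilityMeasure P]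
    (h : IsUniformCoupling n b U V P) :
    HasLaw (fun ω => (fun k => U k ω, V ω)) ((Measure.pi fun _ : Fin n =>
      (volume : Measure ℝ).restrict (Set.Icc (0 : ℝ) 1)).prod (deFinettiMeasure n b)) P :=
  h.indep.hasLaw_prod (iIndepFun.hasLaw_pi h.uniform h.iIndep) h.deFinetti

lemma hasLaw_coupledSpin {Ω : Type*} [MeasurableSpace Ω] {n : ℕ} {b : ℝ}
    {U : Fin n → Ω → ℝ} {V : Ω → ℝ} {P : Measure Ω} [IsProbabilityMeasure P]
    (hn : 0 < n) (hb : 0 < b) (h : IsUniformCoupling n b U V P) :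
    HasLaw (fun ω k => coupledSpin (U k ω) (V ω)) (curieWeissMeasure n b) P := by
  have hm : Measurable fun (q : (Fin n → ℝ) × ℝ) (k : Fin n) => coupledSpin (q.1 k) q.2 :=
    measurable_pi_lambda _ fun k => measurable_coupledSpin.comp
      (f := fun q : (Fin n → ℝ) × ℝ => (q.1 k, q.2)) (by fun_prop)
  exact HasLaw.fun_comp ⟨hm.aemeasurable, map_coupledSpin_eq_curieWeissMeasure hn hb⟩ h.hasLaw_prod

/-! ### Lévy continuity and the two convergences in law. -/

lemma tendstoInDistribution_of_tendsto_charFun {Ω : ℕ → Type*} [∀ n, MeasurableSpace (Ω n)]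
    {Ω' : Type*} [MeasurableSpace Ω'] {E : Type*} [NormedAddCommGroup E] [InnerProductSpace ℝ E]
    [FiniteDimensional ℝ E] [MeasurableSpace E] [BorelSpace E]
    {P : ∀ n, Measure (Ω n)} [∀ n, IsProbabilityMeasure (P n)]
    {Q : Measure Ω'} [IsProbabilityMeasure Q] {X : ∀ n, Ω n → E} {Z : Ω' → E}
    (hX : ∀ n, AEMeasurable (X n) (P n)) (hZ : AEMeasurable Z Q)
    (h : ∀ t, Tendsto (fun n => charFun ((P n).map (X n)) t) atTop (𝓝 (charFun (Q.map Z) t))) :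
    TendstoInDistribution X atTop Z P Q :=
  ⟨hX, hZ, ProbabilityMeasure.tendsto_of_tendsto_charFun h⟩

lemma charFun_map_toLp {Ω : Type*} [MeasurableSpace Ω] {P : Measure Ω} {X : Ω → ℝ × ℝ}
    (hX : AEMeasurable X P) (t : WithLp 2 (ℝ × ℝ)) :
    charFun (P.map fun ω => WithLp.toLp 2 (X ω)) t
      = ∫ ω, Complex.exp ((t.fst * (X ω).1 + t.snd * (X ω).2 : ℝ) * Complex.I) ∂P := by
  have hm : Measurable (WithLp.toLp 2 : ℝ × ℝ → WithLp 2 (ℝ × ℝ)) :=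
    (WithLp.prod_continuous_toLp 2 ℝ ℝ).measurable
  have hX' : AEMeasurable (fun ω => WithLp.toLp 2 (X ω)) P := hm.comp_aemeasurable hX
  rw [charFun_apply, integral_map hX' (by fun_prop)]
  simp [WithLp.prod_inner_apply]

/-- Lévy's continuity theorem for pairs of real random variables. -/
lemma tendstoInDistribution_pair {Ω : ℕ → Type*} [∀ n, MeasurableSpace (Ω n)]
    {Ω' : Type*} [MeasurableSpace Ω']
    {P : ∀ n, Measure (Ω n)} [∀ n, IsProbabilityMeasure (P n)]
    {Q : Measure Ω'} [IsProbabilityMeasure Q] {X : ∀ n, Ω n → ℝ × ℝ} {Z : Ω' → ℝ × ℝ}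
    (hX : ∀ n, AEMeasurable (X n) (P n)) (hZ : AEMeasurable Z Q)
    (h : ∀ s t : ℝ, Tendsto
      (fun n => ∫ ω, Complex.exp ((s * (X n ω).1 + t * (X n ω).2 : ℝ) * Complex.I) ∂P n) atTop
      (𝓝 (∫ ω, Complex.exp ((s * (Z ω).1 + t * (Z ω).2 : ℝ) * Complex.I) ∂Q))) :
    TendstoInDistribution X atTop Z P Q := by
  have hm : Measurable (WithLp.toLp 2 : ℝ × ℝ → WithLp 2 (ℝ × ℝ)) :=
    (WithLp.prod_continuous_toLp 2 ℝ ℝ).measurable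
  -- Characteristic functions require an inner product, so the argument runs in the Euclidean
  -- `WithLp 2 (ℝ × ℝ)` and returns by continuous mapping.
  refine TendstoInDistribution.continuous_comp (WithLp.prod_continuous_ofLp 2 ℝ ℝ)
    (X := fun n ω => WithLp.toLp 2 (X n ω)) (Z := fun ω => WithLp.toLp 2 (Z ω)) ?_
  refine tendstoInDistribution_of_tendsto_charFun (fun n => hm.comp_aemeasurable (hX n))
    (hm.comp_aemeasurable hZ) fun t => ?_
  simp_rw [charFun_map_toLp (hX _), charFun_map_toLp hZ]
  exact h _ _

lemma integral_exp_pair_of_indep {Ω : Type*} [MeasurableSpace Ω] {Q : Measure Ω}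
    [IsProbabilityMeasure Q] {γ : ℝ} {G F : Ω → ℝ} (hG : HasLaw G (gaussianReal 0 1) Q)
    (hF : HasLaw F (limitLaw γ) Q) (hind : IndepFun G F Q) (s t : ℝ) :
    ∫ ω, Complex.exp ((s * G ω + t * F ω : ℝ) * Complex.I) ∂Q
      = Complex.exp (-(s ^ 2 / 2 : ℝ)) * charFun (limitLaw γ) t := by
  have hlaw := hind.hasLaw_prod hG hF
  have h1 := hlaw.integral_comp
    (f := fun q : ℝ × ℝ => Complex.exp ((s * q.1 + t * q.2 : ℝ) * Complex.I))
    (Continuous.aestronglyMeasurable (by fun_prop))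
  simp only [Function.comp_def] at h1
  rw [h1]
  have h2 : ∀ q : ℝ × ℝ, Complex.exp ((s * q.1 + t * q.2 : ℝ) * Complex.I)
      = Complex.exp (s * q.1 * Complex.I) * Complex.exp (t * q.2 * Complex.I) := fun q => by
    rw [← Complex.exp_add]; push_cast; ring_nf
  simp_rw [h2]
  rw [integral_prod_mul (fun x : ℝ => Complex.exp (s * x * Complex.I))
    (fun x : ℝ => Complex.exp (t * x * Complex.I)), ← charFun_apply_real, ← charFun_apply_real,
    charFun_gaussianReal]
  congr 2
  simp

/-- The coupling is imposed only where `n` and `β n` are positive, hence for all large `n`;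
measurability is imposed for every `n`, as convergence in distribution demands it. -/
lemma tendstoInDistribution_coupling {γ : ℝ} {β : ℕ → ℝ}
    (hβ : ∀ n : ℕ, 0 < n → β n = 1 - γ / √(n : ℝ)) {Ω : ℕ → Type*} [∀ n, MeasurableSpace (Ω n)]
    {P : ∀ n, Measure (Ω n)} [∀ n, IsProbabilityMeasure (P n)] {U : ∀ n, Fin n → Ω n → ℝ}
    {V : ∀ n, Ω n → ℝ} {Ω' : Type*} [MeasurableSpace Ω'] {Q : Measure Ω'} [IsProbabilityMeasure Q]
    {G F : Ω' → ℝ} (hU : ∀ n k, AEMeasurable (U n k) (P n)) (hV : ∀ n, AEMeasurable (V n) (P n))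
    (hUV : ∀ n, 0 < n → 0 < β n → IsUniformCoupling n (β n) (U n) (V n) (P n))
    (hG : HasLaw G (gaussianReal 0 1) Q) (hF : HasLaw F (limitLaw γ) Q) (hind : IndepFun G F Q) :
    TendstoInDistribution (fun n ω => rescaledPair (fun k => U n k ω) (V n ω)) atTop
      (fun ω => (G ω, F ω)) P Q := by
  refine tendstoInDistribution_pair (fun n => ?_) (hG.aemeasurable.prodMk hF.aemeasurable)
    fun s t => ?_
  · have hUV' : AEMeasurable (fun ω => (fun k => U n k ω, V n ω)) (P n) :=
      (aemeasurable_pi_lambda _ (hU n)).prodMk (hV n)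
    have hc := (measurable_rescaledPair n).comp_aemeasurable hUV'
    simpa only [Function.comp_def] using hc
  · simp only
    rw [integral_exp_pair_of_indep hG hF hind]
    refine (tendsto_integral_centredSpinChar hβ (tendsto_const_nhds (x := s)) t).congr' ?_
    filter_upwards [eventually_beta_pos hβ] with n hn
    have hlaw := (hUV n hn.1 hn.2).hasLaw_prod
    have h := measurable_rescaledPair n
    have h1 := hlaw.integral_comp (f := fun q : (Fin n → ℝ) × ℝ => Complex.exp
      ((s * (rescaledPair q.1 q.2).1 + t * (rescaledPair q.1 q.2).2 : ℝ) * Complex.I))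
      (Complex.measurable_exp.comp ((Complex.measurable_ofReal.comp
        ((h.fst.const_mul s).add (h.snd.const_mul t))).mul_const _)).aestronglyMeasurable
    rw [← integral_exp_rescaledPair hn.1 hn.2 s t, ← h1]
    rfl

/-- The rescaled magnetisation is `n^(-1/4)` times the first coordinate of `rescaledPair` plus the
second, so its characteristic function at `t` is the joint one at `(t / n^(1/4), t)`. -/
lemma charFun_magnetisation {n : ℕ} {b : ℝ} (hn : 0 < n) (hb : 0 < b) (t : ℝ) :
    ∫ x, Complex.exp (t * ((∑ k, x k) / (n : ℝ) ^ (3 / 4 : ℝ) : ℝ) * Complex.I)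
        ∂curieWeissMeasure n b
      = ∫ y, centredSpinChar (tanh y) (t / (n : ℝ) ^ (1 / 4 : ℝ) / √(n : ℝ)) ^ n
        * Complex.exp ((t * ((n : ℝ) ^ (1 / 4 : ℝ) * tanh y) : ℝ) * Complex.I)
        ∂fieldLaw n b := by
  have hm : Measurable fun (q : (Fin n → ℝ) × ℝ) (k : Fin n) => coupledSpin (q.1 k) q.2 :=
    measurable_pi_lambda _ fun k => measurable_coupledSpin.comp
      (f := fun q : (Fin n → ℝ) × ℝ => (q.1 k, q.2)) (by fun_prop)
  rw [← integral_exp_rescaledPair hn hb, ← map_coupledSpin_eq_curieWeissMeasure hn hb,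
    integral_map hm.aemeasurable (Measurable.aestronglyMeasurable (by fun_prop))]
  refine integral_congr_ae (Eventually.of_forall fun q => ?_)
  have hr := rpow_quarter_pos hn
  simp only [rescaledPair]
  rw [← Complex.ofReal_mul]
  congr 3
  field_simp
  ring

lemma tendstoInDistribution_magnetisation {γ : ℝ} {β : ℕ → ℝ}
    (hβ : ∀ n : ℕ, 0 < n → β n = 1 - γ / √(n : ℝ)) {Ω : ℕ → Type*} [∀ n, MeasurableSpace (Ω n)]
    {P : ∀ n, Measure (Ω n)} [∀ n, IsProbabilityMeasure (P n)] {X : ∀ n, Ω n → Fin n → ℝ}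
    {Ω' : Type*} [MeasurableSpace Ω'] {Q : Measure Ω'} [IsProbabilityMeasure Q] {F : Ω' → ℝ}
    (hXm : ∀ n, AEMeasurable (X n) (P n))
    (hX : ∀ n, 0 < n → 0 < β n → HasLaw (X n) (curieWeissMeasure n (β n)) (P n))
    (hF : HasLaw F (limitLaw γ) Q) :
    TendstoInDistribution (fun (n : ℕ) ω => (∑ k, X n ω k) / (n : ℝ) ^ (3 / 4 : ℝ))
      atTop F P Q := by
  have hmeas : ∀ n : ℕ, Measurable fun x : Fin n → ℝ => (∑ k, x k) / (n : ℝ) ^ (3 / 4 : ℝ) :=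
    fun n => by fun_prop
  have hae : ∀ n : ℕ, AEMeasurable (fun ω => (∑ k, X n ω k) / (n : ℝ) ^ (3 / 4 : ℝ)) (P n) :=
    fun n => (hmeas n).comp_aemeasurable (hXm n)
  refine tendstoInDistribution_of_tendsto_charFun hae hF.aemeasurable fun t => ?_
  have h := tendsto_integral_centredSpinChar hβ (s := 0)
    (σ := fun n : ℕ => t / (n : ℝ) ^ (1 / 4 : ℝ))
    (tendsto_const_nhds.div_atTop tendsto_rpow_quarter) t
  rw [hF.map_eq]
  simp only [ne_eq, OfNat.ofNat_ne_zero, not_false_eq_true, zero_pow, zero_div, neg_zero,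
    Complex.ofReal_zero, Complex.exp_zero, one_mul] at h
  refine h.congr' ?_
  filter_upwards [eventually_beta_pos hβ] with n hn
  rw [charFun_apply_real, integral_map (hae n)
    (Measurable.aestronglyMeasurable (by fun_prop)), ← charFun_magnetisation hn.1 hn.2 t,
    ← (hX n hn.1 hn.2).integral_comp (Measurable.aestronglyMeasurable (by fun_prop))]
  rfl

/-! ### The limit law at `γ = 0` and its Gamma representation. -/

lemma integral_exp_neg_quartic :
    (∫ x : ℝ, exp (-(x ^ 4 / 12)))
      = (3 : ℝ) ^ (1 / 4 : ℝ) * (2 : ℝ) ^ (-(1 / 2) : ℝ) * Gamma (1 / 4) := by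
  have h1 : (∫ x : ℝ, exp (-(x ^ 4 / 12))) = 2 * ∫ x in Set.Ioi (0 : ℝ), exp (-(x ^ 4 / 12)) := by
    rw [← integral_comp_abs (f := fun x => exp (-(x ^ 4 / 12)))]
    simp [Even.pow_abs (show Even 4 by decide)]
  have h2 : (∫ x in Set.Ioi (0 : ℝ), exp (-(x ^ 4 / 12)))
      = (1 / 12 : ℝ) ^ (-1 / 4 : ℝ) * Gamma (1 / 4 + 1) := by
    rw [← integral_exp_neg_mul_rpow (by norm_num) (by norm_num)]
    refine setIntegral_congr_fun measurableSet_Ioi fun x _ => ?_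
    rw [show (4 : ℝ) = ((4 : ℕ) : ℝ) by norm_num, rpow_natCast]
    congr 1; ring
  have h3 : (1 / 12 : ℝ) ^ (-1 / 4 : ℝ) = 3 ^ (1 / 4 : ℝ) * 2 ^ (1 / 2 : ℝ) := by
    rw [one_div, inv_rpow (by norm_num), ← rpow_neg (by norm_num),
      show (12 : ℝ) = 3 * 2 ^ (2 : ℝ) by norm_num, mul_rpow (by norm_num) (by norm_num),
      ← rpow_mul (by norm_num)]
    norm_num
  have h4 : (2 : ℝ) ^ (1 / 2 : ℝ) = 2 * 2 ^ (-(1 / 2) : ℝ) := by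
    rw [show (1 / 2 : ℝ) = 1 + -(1 / 2) by norm_num, rpow_add (by norm_num), rpow_one]
    norm_num
  rw [h1, h2, h3, h4, Gamma_add_one (by norm_num)]
  ring

lemma integral_even_part {f : ℝ → ℂ} {w : ℝ → ℝ} (hw : ∀ x, w (-x) = w x)
    (hf : Integrable fun x => w x • f x) :
    ∫ x, w x • f x = ∫ x in Set.Ioi (0 : ℝ), w x • (f x + f (-x)) := by
  rw [← integral_add_compl measurableSet_Ioi hf (s := Set.Ioi 0), Set.compl_Ioi]
  have h := integral_comp_neg_Ioi (0 : ℝ) (fun x => w x • f x)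
  rw [neg_zero] at h
  have hneg : Integrable fun x => w x • f (-x) := by
    have := hf.comp_neg
    simpa [hw] using this
  simp_rw [smul_add]
  rw [integral_add hf.integrableOn hneg.integrableOn, ← h]
  simp_rw [hw]

/-- Change of variables `y = x⁴ / 12` in integrals against the Gamma law of shape `1 / 4`. -/
lemma integral_gammaMeasure_quartic (φ : ℝ → ℂ) :
    ∫ x, φ ((12 * x) ^ (1 / 4 : ℝ)) ∂gammaMeasure (1 / 4) 1
      = (2 / ∫ x : ℝ, exp (-(x ^ 4 / 12))) •
        ∫ x in Set.Ioi (0 : ℝ), exp (-(x ^ 4 / 12)) • φ x := by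
  have hΓ : 0 < Gamma (1 / 4) := Gamma_pos_of_pos (by norm_num)
  rw [gammaMeasure, integral_withDensity_eq_integral_toReal_smul
    (by unfold gammaPDF; exact (measurable_gammaPDFReal _ _).ennreal_ofReal)
    (by simp [gammaPDF])]
  have h0 : ∀ x : ℝ, x ∉ Set.Ioi (0 : ℝ) →
      (gammaPDF (1 / 4) 1 x).toReal • φ ((12 * x) ^ (1 / 4 : ℝ)) = 0 := by
    intro x hx
    rcases (Set.notMem_Ioi.1 hx).eq_or_lt with rfl | h
    -- At `x = 0` the density vanishes through the convention `0 ^ (1/4 - 1) = 0` of real powers.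
    · simp [gammaPDF, gammaPDFReal]
      norm_num
    · simp [gammaPDF, gammaPDFReal, not_le.2 h]
  rw [← setIntegral_eq_integral_of_forall_compl_eq_zero h0]
  set H : ℝ → ℂ := fun y => (gammaPDF (1 / 4) 1 (y / 12)).toReal • φ (y ^ (1 / 4 : ℝ)) with hH
  have h1 : (∫ x in Set.Ioi (0 : ℝ), (gammaPDF (1 / 4) 1 x).toReal • φ ((12 * x) ^ (1 / 4 : ℝ)))
      = ∫ x in Set.Ioi (0 : ℝ), H (12 * x) := by
    refine setIntegral_congr_fun measurableSet_Ioi fun x _ => ?_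
    simp [hH]
  -- Two substitutions: scaling by `12`, then `y = x ^ 4`, whose Jacobian `4 x³` cancels the `x⁻³`
  -- of the Gamma density.
  rw [h1, integral_comp_mul_left_Ioi H 0 (by norm_num : (0 : ℝ) < 12), mul_zero,
    ← integral_comp_rpow_Ioi H (by norm_num : (4 : ℝ) ≠ 0), ← integral_smul, ← integral_smul]
  refine setIntegral_congr_fun measurableSet_Ioi fun x hx => ?_
  have hx : 0 < x := hx
  have e4 : x ^ (4 : ℝ) = x ^ 4 := by
    rw [show (4 : ℝ) = ((4 : ℕ) : ℝ) by norm_num, rpow_natCast]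
  have e3 : x ^ ((4 : ℝ) - 1) = x ^ 3 := by
    rw [show (4 : ℝ) - 1 = ((3 : ℕ) : ℝ) by norm_num, rpow_natCast]
  have er : (x ^ 4) ^ (1 / 4 : ℝ) = x := by
    rw [← e4, ← rpow_mul hx.le]; norm_num
  have ed : (x ^ 4 / 12) ^ ((1 / 4 : ℝ) - 1) = (x ^ 3)⁻¹ * 12 ^ (3 / 4 : ℝ) := by
    rw [div_rpow (by positivity) (by norm_num), ← e4, ← rpow_mul hx.le,
      show (4 : ℝ) * (1 / 4 - 1) = -((3 : ℕ) : ℝ) by norm_num, rpow_neg hx.le, rpow_natCast,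
      show (1 / 4 : ℝ) - 1 = -(3 / 4) by norm_num, rpow_neg (by norm_num), div_inv_eq_mul]
  have ep : (gammaPDF (1 / 4) 1 (x ^ 4 / 12)).toReal
      = (Gamma (1 / 4))⁻¹ * ((x ^ 3)⁻¹ * 12 ^ (3 / 4 : ℝ)) * exp (-(x ^ 4 / 12)) := by
    rw [gammaPDF, ENNReal.toReal_ofReal (gammaPDFReal_nonneg (by norm_num) (by norm_num) _),
      gammaPDFReal, if_pos (by positivity), ed]
    simp
  -- As `3^(1/4) 2^(-1/2) = 12^(1/4) / 2`, the product is `12 / 2`.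
  have ec : (12 : ℝ) ^ (3 / 4 : ℝ) * ((3 : ℝ) ^ (1 / 4 : ℝ) * (2 : ℝ) ^ (-(1 / 2) : ℝ)) = 6 := by
    rw [show (12 : ℝ) = 3 * 2 ^ (2 : ℝ) by norm_num, mul_rpow (by norm_num) (by norm_num),
      ← rpow_mul (by norm_num)]
    have a : (3 : ℝ) ^ (3 / 4 : ℝ) * 3 ^ (1 / 4 : ℝ) = 3 := by
      rw [← rpow_add (by norm_num)]; norm_num
    have b : (2 : ℝ) ^ (2 * (3 / 4) : ℝ) * 2 ^ (-(1 / 2) : ℝ) = 2 := by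
      rw [← rpow_add (by norm_num)]; norm_num
    calc _ = ((3 : ℝ) ^ (3 / 4 : ℝ) * 3 ^ (1 / 4 : ℝ))
          * ((2 : ℝ) ^ (2 * (3 / 4) : ℝ) * 2 ^ (-(1 / 2) : ℝ)) := by ring
      _ = 6 := by rw [a, b]; norm_num
  simp only [hH]
  rw [e4, e3, er, ep, integral_exp_neg_quartic, smul_smul, smul_smul, smul_smul]
  congr 1
  have p3 : (0 : ℝ) < 3 ^ (1 / 4 : ℝ) := by positivity
  have p2 : (0 : ℝ) < 2 ^ (-(1 / 2) : ℝ) := by positivity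
  set A := (3 : ℝ) ^ (1 / 4 : ℝ)
  set B := (2 : ℝ) ^ (-(1 / 2) : ℝ)
  have ec' : (12 : ℝ) ^ (3 / 4 : ℝ) = 6 / (A * B) := by
    rw [eq_div_iff (by positivity)]; exact ec
  rw [ec', abs_of_pos (by norm_num : (0 : ℝ) < 4)]
  field_simp
  norm_num

/-- The quartic law as the law of a signed power of a Gamma variable. -/
lemma hasLaw_sign_mul_gamma {Ω : Type*} [MeasurableSpace Ω] {P : Measure Ω}
    [IsProbabilityMeasure P] {B g : Ω → ℝ} (hB : HasLaw B spinLaw P)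
    (hg : HasLaw g (gammaMeasure (1 / 4) 1) P) (hind : IndepFun B g P) :
    HasLaw (fun ω => B ω * (12 * g ω) ^ (1 / 4 : ℝ)) (limitLaw 0) P := by
  have hgp : IsProbabilityMeasure (gammaMeasure (1 / 4) 1) :=
    isProbabilityMeasure_gammaMeasure (by norm_num) (by norm_num)
  have hlaw := hind.hasLaw_prod hB hg
  have hm : Measurable fun q : ℝ × ℝ => q.1 * (12 * q.2) ^ (1 / 4 : ℝ) := by fun_prop
  have hae : AEMeasurable (fun ω => B ω * (12 * g ω) ^ (1 / 4 : ℝ)) P :=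
    hm.comp_aemeasurable hlaw.aemeasurable
  refine ⟨hae, ?_⟩
  have := Measure.isProbabilityMeasure_map hae
  refine Measure.ext_of_charFun (funext fun t => ?_)
  rw [charFun_apply_real, charFun_apply_real, integral_map hae (by fun_prop)]
  have h1 := hlaw.integral_comp (f := fun q : ℝ × ℝ =>
    Complex.exp (t * (q.1 * (12 * q.2) ^ (1 / 4 : ℝ) : ℝ) * Complex.I))
    (Measurable.aestronglyMeasurable (by fun_prop))
  simp only [Function.comp_def] at h1
  rw [h1, integral_prod_symm]
  swap
  · refine Integrable.of_bound (Measurable.aestronglyMeasurable (by fun_prop)) 1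
      (Eventually.of_forall fun q => ?_)
    rw [← Complex.ofReal_mul]
    exact (Complex.norm_exp_ofReal_mul_I _).le
  simp_rw [integral_spinLaw]
  have h2 := integral_gammaMeasure_quartic fun x =>
    (1 / 2 : ℝ) • Complex.exp (t * ((1 * x : ℝ) : ℂ) * Complex.I)
      + (1 / 2 : ℝ) • Complex.exp (t * ((-1 * x : ℝ) : ℂ) * Complex.I)
  rw [h2, limitLaw, integral_tilted_eq_smul]
  have hint : Integrable fun x : ℝ => exp (-(x ^ 4 / 12)) • Complex.exp (t * x * Complex.I) := by
    have := integrable_exp_limit 0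
    simp only [zero_mul, sub_zero] at this
    refine this.smul_of_top_left ?_
    refine memLp_top_of_bound (Continuous.aestronglyMeasurable (by fun_prop)) 1
      (Eventually.of_forall fun x => ?_)
    rw [← Complex.ofReal_mul]
    exact (Complex.norm_exp_ofReal_mul_I _).le
  simp only [zero_mul, sub_zero]
  -- Averaging over the sign leaves the even part of the exponential on the half-line; folding the
  -- quartic integral at `0` yields the same expression.
  rw [integral_even_part (w := fun x => exp (-(x ^ 4 / 12)))
    (fun x => by simp [Even.neg_pow (show Even 4 by decide)]) hint,
    div_eq_inv_mul, mul_smul, ← integral_smul (2 : ℝ)]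
  congr 1
  refine setIntegral_congr_fun measurableSet_Ioi fun x _ => ?_
  simp only [one_mul, neg_mul, ← smul_add, smul_smul, Complex.ofReal_neg]
  congr 1
  ring

end CurieWeiss

end

theorem mainTheorem4 (γ : ℝ) (β : ℕ → ℝ) (hβ : ∀ n : ℕ, 0 < n → β n = 1 - γ / √(n : ℝ)) :
    -- all the laws involved are probability measures
    (IsProbabilityMeasure (CurieWeiss.limitLaw γ) ∧
      (∀ (n : ℕ) (b : ℝ), IsProbabilityMeasure (CurieWeiss.curieWeissMeasure n b)) ∧
      (∀ (n : ℕ) (b : ℝ), 0 < n → 0 < b →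
        IsProbabilityMeasure (CurieWeiss.deFinettiMeasure n b))) ∧
    -- convergence of the rescaled magnetisation of Curie-Weiss spins `X n` at inverse temperature `β n`
    (∀ (Ω : ℕ → Type*) [∀ n, MeasurableSpace (Ω n)] (P : ∀ n, Measure (Ω n))
        [∀ n, IsProbabilityMeasure (P n)] (X : ∀ n, Ω n → Fin n → ℝ)
        (Ω' : Type*) [MeasurableSpace Ω'] (Q : Measure Ω') [IsProbabilityMeasure Q] (F : Ω' → ℝ),
        (∀ n, AEMeasurable (X n) (P n)) →
        (∀ n, 0 < n → 0 < β n → HasLaw (X n) (CurieWeiss.curieWeissMeasure n (β n)) (P n)) →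
        HasLaw F (CurieWeiss.limitLaw γ) Q →
        TendstoInDistribution (fun (n : ℕ) ω => (∑ k, X n ω k) / (n : ℝ) ^ (3 / 4 : ℝ)) atTop F P Q) ∧
    -- the spins `2 · 1_{U k < V} - 1` are Curie-Weiss spins
    (∀ (n : ℕ) (b : ℝ) (Ω : Type*) [MeasurableSpace Ω] (P : Measure Ω) [IsProbabilityMeasure P]
        (U : Fin n → Ω → ℝ) (V : Ω → ℝ),
        0 < n → 0 < b → CurieWeiss.IsUniformCoupling n b U V P →
        HasLaw (fun ω k => CurieWeiss.coupledSpin (U k ω) (V ω))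
          (CurieWeiss.curieWeissMeasure n b) P) ∧
    -- joint convergence, with `T n = 2 * V n - 1`
    (∀ (Ω : ℕ → Type*) [∀ n, MeasurableSpace (Ω n)] (P : ∀ n, Measure (Ω n))
        [∀ n, IsProbabilityMeasure (P n)] (U : ∀ n, Fin n → Ω n → ℝ) (V M T : ∀ n, Ω n → ℝ)
        (Ω' : Type*) [MeasurableSpace Ω'] (Q : Measure Ω') [IsProbabilityMeasure Q]
        (G F : Ω' → ℝ),
        (∀ n k, AEMeasurable (U n k) (P n)) → (∀ n, AEMeasurable (V n) (P n)) →
        (∀ n, 0 < n → 0 < β n → CurieWeiss.IsUniformCoupling n (β n) (U n) (V n) (P n)) →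
        (∀ n ω, M n ω = ∑ k, CurieWeiss.coupledSpin (U n k ω) (V n ω)) →
        (∀ n ω, T n ω = 2 * V n ω - 1) →
        HasLaw G (gaussianReal 0 1) Q → HasLaw F (CurieWeiss.limitLaw γ) Q → IndepFun G F Q →
        TendstoInDistribution
          (fun (n : ℕ) ω =>
            ((n : ℝ) ^ (1 / 4 : ℝ) *
                (M n ω / (n : ℝ) ^ (3 / 4 : ℝ) - (n : ℝ) ^ (1 / 4 : ℝ) * T n ω),
              (n : ℝ) ^ (1 / 4 : ℝ) * T n ω))
          atTop (fun ω => (G ω, F ω)) P Q) ∧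
    -- the limit law for `γ = 0`: its normalising constant and its representation in law
    ((∫ x : ℝ, Real.exp (-(x ^ 4 / 12)))
        = (3 : ℝ) ^ (1 / 4 : ℝ) * (2 : ℝ) ^ (-(1 / 2) : ℝ) * Real.Gamma (1 / 4)) ∧
    (∀ (Ω : Type*) [MeasurableSpace Ω] (P : Measure Ω) [IsProbabilityMeasure P]
        (B g : Ω → ℝ),
        HasLaw B CurieWeiss.spinLaw P → HasLaw g (gammaMeasure (1 / 4) 1) P → IndepFun B g P →
        HasLaw (fun ω => B ω * (12 * g ω) ^ (1 / 4 : ℝ)) (CurieWeiss.limitLaw 0) P) := by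
  refine ⟨⟨inferInstance, inferInstance, fun n b hn hb =>
    CurieWeiss.isProbabilityMeasure_deFinettiMeasure hn hb⟩, ?_, ?_, ?_,
    CurieWeiss.integral_exp_neg_quartic, ?_⟩
  · intro Ω _ P _ X Ω' _ Q _ F hXm hX hF
    exact CurieWeiss.tendstoInDistribution_magnetisation hβ hXm hX hF
  · intro n b Ω _ P _ U V hn hb h
    exact CurieWeiss.hasLaw_coupledSpin hn hb h
  · intro Ω _ P _ U V M T Ω' _ Q _ G F hU hV hUV hM hT hG hF hind
    simp only [hM, hT]
    exact CurieWeiss.tendstoInDistribution_coupling hβ hU hV hUV hG hF hind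
  · intro Ω _ P _ B g hB hg hind
    exact CurieWeiss.hasLaw_sign_mul_gamma hB hg hind
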